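/- Let $N\ge 2$, $b\ge 2$, $r\ge 1$ be integers, let $\alpha\in(0,1)$, $\varepsilon>0$, and let $\mu_1\ge\mu_2\ge\dots\ge\mu_N\ge\varepsilon$ be real numbers with $\sum_{n=1}^N\mu_n=N$. Consider $N$ parallel servers. Jobs arrive according to a Poisson process of rate $\lambda N$ with $\lambda=1-N^{-\alpha}$, server $n$ has exponential service times with service rate $\mu_n$, and each server holds at most $b$ jobs (one in service and $b-1$ in its buffer). Under the Join-the-Fastest-Shortest-Queue (JFSQ) policy an arriving job is routed to a server with the shortest queue, among these to one with the largest service rate, remaining ties being broken uniformly at random; the job is discarded if that server already holds $b$ jobs. Let $Q=(Q_1,\dots,Q_N)$ be distributed according to the steady-state (stationary) distribution of the resulting continuous-time Markov chain on $\{0,\dots,b\}^N$ of queue lengths (jobs in service included), and let $\bar Q=\frac1N\sum_{n=1}^N Q_n$. Here $\log$ is the natural logarithm. 1) (Sub-Halfin–Whitt regime.) Suppose $\alpha\in(0,\tfrac12)$, $$\max\left\{\frac{2(r+1)}{\log N},\ \frac{27(r+1)\,b\log N}{N^{0.25-0.5\alpha}}\right\}\le\varepsilon\le 0.5,\qquad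 \frac{\mu_1}{\varepsilon^2}\le\frac{N^{1-\alpha}}{64\,b\,(2\log^2N+3)},$$ and that there is an index $N_2\in\{1,\dots,N\}$ with $\sum_{n=1}^{N_2}\mu_n=\lambda N$. Put $k_{sub}=\frac{16(b-1)\mu_{N_2}}{\varepsilon^2}$. Then $$\mathbb E\left[\left(\max\left\{\bar Q-\frac{N_2}{N}-\left(1-\frac{4}{k_{sub}\,\varepsilon}\right)\frac1{N^{\alpha}},\,0\right\}\right)^r\right]\le\left(\frac{k_{sub}}{N^{1-\alpha}}\right)^r .$$ 2) (Super-Halfin–Whitt regime.) Suppose $\alpha\in[\tfrac12,1)$ and $$\frac{\mu_1}{\varepsilon}\le\frac{N^{1-\alpha}}{24\,r\,b\log^2N}.$$ Put $k_{super}=\frac{24\,r\,(b-1)\mu_1}{\varepsilon}$. Then $$\mathbb E\left[\left(\max\left\{\bar Q-1-\frac{k_{super}\log N}{N^{1-\alpha}},\,0\right\}\right)^r\right]\le 10\left(\frac{2r}{N^{1-\alpha}}\right)^r .$$ -/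

import Mathlib

open Finset

namespace JFSQ

/-- Queue-length vectors of `N` servers: every server holds at most `b` jobs, one in service and
`b - 1` in its buffer. -/
abbrev State (N b : ℕ) : Type := Fin N → Fin (b + 1)

/-- The servers to which Join-the-Fastest-Shortest-Queue may send a job that finds the queue lengths
`q`: those of largest service rate among the servers with the shortest queue. -/
noncomputable def fastestShortest {N b : ℕ} (μ : Fin N → ℝ) (q : State N b) : Finset (Fin N) :=
  open Classical in
  univ.filter fun n => (∀ m, q n ≤ q m) ∧ ∀ m, (∀ l, q m ≤ q l) → μ m ≤ μ n

/-- The probability that a job arriving in state `q` is routed to server `n` (ties in both queue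
length and service rate are broken uniformly at random). -/
noncomputable def routeProb {N b : ℕ} (μ : Fin N → ℝ) (q : State N b) (n : Fin N) : ℝ :=
  open Classical in
  if n ∈ fastestShortest μ q then 1 / ((fastestShortest μ q).card : ℝ) else 0

/-- The state after a job has been routed to server `n`; the job is discarded if the server already
holds `b` jobs. -/
def arrive {N b : ℕ} (q : State N b) (n : Fin N) : State N b :=
  Function.update q n ⟨min ((q n : ℕ) + 1) b, by omega⟩

/-- The state after a service completion at server `n` (nothing happens at an idle server). -/
def depart {N b : ℕ} (q : State N b) (n : Fin N) : State N b :=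
  Function.update q n ⟨(q n : ℕ) - 1, by omega⟩

/-- The rate of jumps from `q` to a different state `q'` when jobs arrive as a Poisson process of
rate `Λ` and service at server `n` is exponential with rate `μ n`. -/
noncomputable def rate {N b : ℕ} (Λ : ℝ) (μ : Fin N → ℝ) (q q' : State N b) : ℝ :=
  (∑ n, if arrive q n = q' then Λ * routeProb μ q n else 0) +
    ∑ n, if depart q n = q' then μ n else 0

/-- The generator (Q-matrix) of the queue-length Markov chain under JFSQ. -/
noncomputable def generator {N b : ℕ} (Λ : ℝ) (μ : Fin N → ℝ) :
    Matrix (State N b) (State N b) ℝ :=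
  Matrix.of fun q q' =>
    if q = q' then -∑ z ∈ univ.erase q, rate Λ μ q z else rate Λ μ q q'

/-- The transition matrix of the queue-length Markov chain over a time span `t`. -/
noncomputable def transition {N b : ℕ} (Λ : ℝ) (μ : Fin N → ℝ) (t : ℝ) :
    Matrix (State N b) (State N b) ℝ :=
  NormedSpace.exp (t • generator Λ μ)

/-- `π` is a steady-state (stationary) distribution of the queue-length Markov chain: a probability
vector that is preserved by the transition matrices at all times. -/
def IsSteadyState {N b : ℕ} (Λ : ℝ) (μ : Fin N → ℝ) (π : State N b → ℝ) : Prop :=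
  π ∈ stdSimplex ℝ (State N b) ∧ ∀ t : ℝ, 0 ≤ t → Matrix.vecMul π (transition Λ μ t) = π

/-- Expectation of `f(Q)` when `Q` has distribution `π`. -/
def expect {N b : ℕ} (π : State N b → ℝ) (f : State N b → ℝ) : ℝ := ∑ q, π q * f q

/-- The average queue length. -/
noncomputable def avgQueue {N b : ℕ} (q : State N b) : ℝ := (1 / (N : ℝ)) * ∑ n, ((q n : ℕ) : ℝ)

/-- The normalized load `λ = 1 - N ^ (-α)`. -/
noncomputable def load (N : ℕ) (α : ℝ) : ℝ := 1 - (N : ℝ) ^ (-α)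

/-- The condition on the parameters in the Sub-Halfin-Whitt regime (`μ₁` is the largest rate). -/
def SubCondition (N b r : ℕ) (α ε μ₁ : ℝ) : Prop :=
  max (2 * ((r : ℝ) + 1) / Real.log N)
      (27 * ((r : ℝ) + 1) * b * Real.log N / (N : ℝ) ^ (0.25 - 0.5 * α)) ≤ ε ∧
    ε ≤ 0.5 ∧
    μ₁ / ε ^ 2 ≤ (N : ℝ) ^ (1 - α) / (64 * b * (2 * Real.log N ^ 2 + 3))

/-- The condition on the parameters in the Super-Halfin-Whitt regime (`μ₁` is the largest rate). -/
def SuperCondition (N b r : ℕ) (α ε μ₁ : ℝ) : Prop :=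
  μ₁ / ε ≤ (N : ℝ) ^ (1 - α) / (24 * r * b * Real.log N ^ 2)

/-- `k_sub`, where `μN₂` is the rate of the slowest of the `N₂` fastest servers. -/
noncomputable def kSub (b : ℕ) (ε μN₂ : ℝ) : ℝ := 16 * ((b : ℝ) - 1) * μN₂ / ε ^ 2

/-- `k_super`, where `μ₁` is the largest rate. -/
noncomputable def kSuper (b r : ℕ) (ε μ₁ : ℝ) : ℝ := 24 * r * ((b : ℝ) - 1) * μ₁ / ε

end JFSQ

/-!
Under a stationary distribution the generator of every function has mean zero. A function whose
jumps are at most `1` and whose drift is at most `-γ` outside a bad set therefore has geometric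
tails, up to a multiple of the probability of the bad set: raising the level by a fixed amount
contracts the tail by a fixed factor.

In the super-Halfin–Whitt regime the minimum of the number of idle servers and the excess of the
number of waiting jobs over a threshold is small with high probability, because arrivals join idle
servers as long as there are any. When many jobs are present and this minimum is small, nearly all
servers are busy, so the total number of jobs drifts down and its tail yields the moment bound.

In the sub-Halfin–Whitt regime arrivals go to the fastest idle server. Hence, if the servers of rate
at least `y` together cannot serve all arrivals, the number of idle ones among them has only
diffusive fluctuations. Summation over the level sets of the rates shows that, once the number of
busy servers exceeds `N₂` by half of `N ^ (1 - α)`, they serve faster than jobs arrive, except with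
negligible probability. The number of waiting jobs plus a convex function of the number of busy
servers then drifts down.
-/

namespace JFSQ

section JumpRates

variable {S : Type*} [Fintype S]

/-- The probability of the event `E` under the distribution with mass function `π`. -/
noncomputable def prob (π : S → ℝ) (E : Set S) : ℝ := ∑ s, E.indicator π s

/-- The generator of the jump process on `S` with jump rates `R`, applied to `f`. The diagonal
of `R` plays no role. -/
def gen (R : S → S → ℝ) (f : S → ℝ) (s : S) : ℝ := ∑ s', R s s' * (f s' - f s)

/-- `π` is an invariant distribution of the jump process with rates `R`, in the weak form that
every function has a generator of mean zero. -/
structure IsInvariant (R : S → S → ℝ) (π : S → ℝ) : Prop where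
  mem_stdSimplex : π ∈ stdSimplex ℝ S
  sum_mul_gen : ∀ f, ∑ s, π s * gen R f s = 0

theorem prob_eq_sum_mul_indicator (π : S → ℝ) (E : Set S) :
    prob π E = ∑ s, π s * E.indicator 1 s := by
  classical
  simp only [prob, Set.indicator_apply, Pi.one_apply, mul_ite, mul_one, mul_zero]

theorem prob_empty (π : S → ℝ) : prob π ∅ = 0 := by simp [prob]

section Distribution

variable {π : S → ℝ} (hπ : π ∈ stdSimplex ℝ S)

include hπ

theorem prob_nonneg (E : Set S) : 0 ≤ prob π E :=
  sum_nonneg fun s _ => Set.indicator_nonneg (fun s _ => hπ.1 s) s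

theorem prob_mono {E F : Set S} (h : E ⊆ F) : prob π E ≤ prob π F :=
  sum_le_sum fun s _ => Set.indicator_le_indicator_of_subset h hπ.1 s

theorem prob_le_one (E : Set S) : prob π E ≤ 1 := by
  rw [← hπ.2]
  exact sum_le_sum fun s _ => Set.indicator_le_self' (fun s _ => hπ.1 s) s

theorem prob_biUnion_le {ι : Type*} (t : Finset ι) (E : ι → Set S) :
    prob π (⋃ i ∈ t, E i) ≤ ∑ i ∈ t, prob π (E i) := by
  classical
  simp only [prob]
  rw [sum_comm]
  have nonneg : ∀ s, ∀ i ∈ t, 0 ≤ (E i).indicator π s := fun s i _ =>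
    Set.indicator_nonneg (fun s _ => hπ.1 s) s
  refine sum_le_sum fun s _ => ?_
  by_cases hs : s ∈ ⋃ i ∈ t, E i
  · obtain ⟨i, hi, hsi⟩ := Set.mem_iUnion₂.1 hs
    rw [Set.indicator_of_mem hs, ← Set.indicator_of_mem hsi π]
    exact single_le_sum (nonneg s) hi
  · rw [Set.indicator_of_notMem hs]
    exact sum_nonneg (nonneg s)

theorem sum_mul_le_mul_prob {f : S → ℝ} {E : Set S} {C : ℝ} (hC : ∀ s ∈ E, f s ≤ C)
    (h0 : ∀ s ∉ E, f s ≤ 0) : ∑ s, π s * f s ≤ C * prob π E := by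
  rw [prob_eq_sum_mul_indicator, mul_sum]
  refine sum_le_sum fun s _ => ?_
  rw [mul_left_comm]
  refine mul_le_mul_of_nonneg_left ?_ (hπ.1 s)
  by_cases hs : s ∈ E
  · simpa [hs] using hC s hs
  · simpa [hs] using h0 s hs

end Distribution

theorem sum_rate_mul_mono {R : S → S → ℝ} (hR : ∀ s s', 0 ≤ R s s') {f g : S → ℝ} {s : S}
    (h : ∀ s', R s s' ≠ 0 → f s' ≤ g s') : ∑ s', R s s' * f s' ≤ ∑ s', R s s' * g s' := by
  refine sum_le_sum fun s' _ => ?_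
  by_cases h0 : R s s' = 0
  · simp [h0]
  · exact mul_le_mul_of_nonneg_left (h s' h0) (hR s s')

variable {R : S → S → ℝ} {π : S → ℝ} {V : S → ℝ} {bad : Set S} {U γ : ℝ}

-- The test function is `max (V - c) 0`: its generator vanishes or is negative for `V ≤ c - 1`
-- and agrees with that of `V` for `c + 1 ≤ V`.
theorem prob_le_step_of_drift (hR : ∀ s s', 0 ≤ R s s') (hπ : IsInvariant R π)
    (hU : 0 ≤ U) (hγ : 0 ≤ γ) {c : ℝ}
    (hjump : ∀ s s', R s s' ≠ 0 → |V s' - V s| ≤ 1)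
    (hup : ∀ s, c - 1 < V s → ∑ s', R s s' * max (V s' - V s) 0 ≤ U)
    (hdrift : ∀ s, c + 1 ≤ V s → s ∉ bad → gen R V s ≤ -γ) :
    (U + γ) * prob π {s | c + 1 ≤ V s} ≤
      U * prob π {s | c - 1 < V s} + (U + γ) * prob π bad := by
  let f : S → ℝ := fun s => max (V s - c) 0
  have low : ∀ s, V s ≤ c - 1 → gen R f s ≤ 0 := fun s hs => by
    refine (sum_rate_mul_mono hR (g := fun _ => 0) fun s' h => ?_).trans_eq (by simp)
    have := (abs_le.1 (hjump s s' h)).2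
    simp [f, max_eq_right (by linarith : V s - c ≤ 0), max_eq_right (by linarith : V s' - c ≤ 0)]
  have mid : ∀ s, c - 1 < V s → gen R f s ≤ U := fun s hs =>
    (sum_rate_mul_mono hR fun s' _ => (max_sub_max_le_max _ _ _ _).trans_eq
      (by rw [sub_sub_sub_cancel_right, sub_zero])).trans (hup s hs)
  have high : ∀ s, c + 1 ≤ V s → s ∉ bad → gen R f s ≤ -γ := fun s hs hb => by
    refine (sum_rate_mul_mono hR fun s' h => ?_).trans (hdrift s hs hb)
    have := (abs_le.1 (hjump s s' h)).1
    simp [f, max_eq_left (by linarith : 0 ≤ V s - c), max_eq_left (by linarith : 0 ≤ V s' - c)]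
  have key : ∀ s, gen R f s ≤ U * {s | c - 1 < V s}.indicator 1 s + (U + γ) * bad.indicator 1 s
      - (U + γ) * {s | c + 1 ≤ V s}.indicator 1 s := fun s => by
    classical
    simp only [Set.indicator_apply, Set.mem_ofPred_eq, Pi.one_apply]
    rcases le_or_gt (V s) (c - 1) with hl | hl
    · rw [if_neg hl.not_gt, if_neg (by linarith : ¬c + 1 ≤ V s)]
      split_ifs <;> linarith [low s hl]
    · rw [if_pos hl]
      split_ifs with hb hu hu
      exacts [by linarith [mid s hl], by linarith [mid s hl], by linarith [high s hu hb],
        by linarith [mid s hl]]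
  have h := sum_le_sum fun s (_ : s ∈ univ) =>
    mul_le_mul_of_nonneg_left (key s) (hπ.mem_stdSimplex.1 s)
  simp only [hπ.sum_mul_gen, mul_sub, mul_add, sum_sub_distrib, sum_add_distrib,
    mul_left_comm (π _), ← mul_sum, ← prob_eq_sum_mul_indicator] at h
  linarith

theorem le_exp_add_of_contraction {T : ℕ → ℝ} {β : ℝ} (hU : 0 ≤ U) (hγ : 0 < γ) (hβ : 0 ≤ β)
    (h0 : T 0 ≤ 1) (hT : ∀ n, (U + γ) * T (n + 1) ≤ U * T n + (U + γ) * β) (n : ℕ) :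
    T n ≤ Real.exp (-(n * (γ / (U + γ)))) + β * ((U + γ) / γ) := by
  have hp : 0 < U + γ := by linarith
  have hratio : U / (U + γ) = 1 - γ / (U + γ) := by field_simp; ring
  have geom : T n ≤ (U / (U + γ)) ^ n + β * ((U + γ) / γ) := by
    induction n with
    | zero => simpa using h0.trans (le_add_of_nonneg_right (by positivity))
    | succ n ih =>
      calc T (n + 1) ≤ U / (U + γ) * T n + β := by
            rw [div_mul_eq_mul_div, div_add' _ _ _ hp.ne', le_div_iff₀ hp]; linarith [hT n]
        _ ≤ U / (U + γ) * ((U / (U + γ)) ^ n + β * ((U + γ) / γ)) + β := by gcongr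
        _ = (U / (U + γ)) ^ (n + 1) + β * ((U + γ) / γ) := by rw [pow_succ']; field_simp; ring
  refine geom.trans (add_le_add_left ?_ _)
  calc (U / (U + γ)) ^ n ≤ Real.exp (-(γ / (U + γ))) ^ n := by
        rw [hratio]
        exact pow_le_pow_left₀ (hratio ▸ by positivity) (Real.one_sub_le_exp_neg _) n
    _ = _ := by rw [← Real.exp_nat_mul, mul_neg]

theorem prob_le_exp_of_drift (hR : ∀ s s', 0 ≤ R s s') (hπ : IsInvariant R π)
    (hU : 0 ≤ U) (hγ : 0 < γ) {c : ℝ}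
    (hjump : ∀ s s', R s s' ≠ 0 → |V s' - V s| ≤ 1)
    (hup : ∀ s, c ≤ V s → ∑ s', R s s' * max (V s' - V s) 0 ≤ U)
    (hdrift : ∀ s, c < V s → s ∉ bad → gen R V s ≤ -γ) (n : ℕ) :
    prob π {s | c + 2 * n ≤ V s} ≤
      Real.exp (-(n * (γ / (U + γ)))) + prob π bad * ((U + γ) / γ) := by
  refine le_exp_add_of_contraction (T := fun n : ℕ => prob π {s | c + 2 * n ≤ V s}) hU hγ
    (prob_nonneg hπ.1 _) (prob_le_one hπ.1 _) (fun n => ?_) n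
  have := n.cast_nonneg (α := ℝ)
  have step := prob_le_step_of_drift hR hπ hU hγ.le (c := c + 2 * n + 1) hjump
    (fun s hs => hup s (by linarith)) (fun s hs => hdrift s (by linarith))
  have hsub : {s | c + 2 * n + 1 - 1 < V s} ⊆ {s | c + 2 * n ≤ V s} := fun s hs => by
    simp only [Set.mem_ofPred_eq] at hs ⊢
    linarith
  calc (U + γ) * prob π {s | c + 2 * (n + 1 : ℕ) ≤ V s}
      = (U + γ) * prob π {s | c + 2 * n + 1 + 1 ≤ V s} := by push_cast; ring_nf
    _ ≤ _ := step.trans (by gcongr; exact prob_mono hπ.1 hsub)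

theorem prob_le_exp_of_drift_int {V : S → ℤ} (hR : ∀ s s', 0 ≤ R s s') (hπ : IsInvariant R π)
    (hU : 0 ≤ U) (hγ : 0 < γ) {c : ℤ}
    (hjump : ∀ s s', R s s' ≠ 0 → |V s' - V s| ≤ 1)
    (hup : ∀ s, c ≤ V s → ∑ s', R s s' * ((max (V s' - V s) 0 : ℤ) : ℝ) ≤ U)
    (hdrift : ∀ s, c < V s → s ∉ bad → gen R (fun s => (V s : ℝ)) s ≤ -γ) (n : ℕ) :
    prob π {s | c + n ≤ V s} ≤
      Real.exp (-(n * (γ / (U + γ)))) + prob π bad * ((U + γ) / γ) := by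
  refine le_exp_add_of_contraction (T := fun n : ℕ => prob π {s | c + n ≤ V s}) hU hγ
    (prob_nonneg hπ.1 _) (prob_le_one hπ.1 _) (fun n => ?_) n
  have step := prob_le_step_of_drift hR hπ (V := fun s => (V s : ℝ)) (bad := bad) hU hγ.le
    (c := ((c + n : ℤ) : ℝ)) (fun s s' h => by exact_mod_cast hjump s s' h)
    (fun s hs => by exact_mod_cast hup s (by have : c + n - 1 < V s := mod_cast hs; omega))
    (fun s hs => hdrift s (by have : c + n + 1 ≤ V s := mod_cast hs; omega))
  have hup' : {s | ((c + n : ℤ) : ℝ) + 1 ≤ V s} = {s | c + (n + 1 : ℕ) ≤ V s} := by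
    ext s; simp only [Set.mem_ofPred_eq]; norm_cast; omega
  have hlow' : {s | ((c + n : ℤ) : ℝ) - 1 < V s} = {s | c + n ≤ V s} := by
    ext s; simp only [Set.mem_ofPred_eq]; norm_cast; omega
  rwa [hup', hlow'] at step

end JumpRates

section Moments

theorem pow_le_mul_exp {φ x : ℝ} (hφ : 0 < φ) (hx : 0 ≤ x) (r : ℕ) :
    x ^ r ≤ (r / (2 * φ)) ^ r * Real.exp (φ * x) := by
  rcases r.eq_zero_or_pos with rfl | hr
  · simpa using Real.one_le_exp (by positivity : 0 ≤ φ * x)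
  have hr' : (0 : ℝ) < r := by exact_mod_cast hr
  have base : x ≤ r / (2 * φ) * Real.exp (φ * x / r) :=
    calc x = r / (2 * φ) * (2 * (φ * x / r)) := by field_simp
      _ ≤ _ := by gcongr; exact Real.two_mul_le_exp
  calc x ^ r ≤ (r / (2 * φ) * Real.exp (φ * x / r)) ^ r := by gcongr
    _ = (r / (2 * φ)) ^ r * Real.exp (φ * x) := by
      rw [mul_pow, ← Real.exp_nat_mul, mul_div_cancel₀ _ hr'.ne']

theorem sum_range_sub_mul_pow_succ {a : ℕ → ℝ} (h0 : a 0 = 0) (t : ℝ) (M : ℕ) :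
    ∑ j ∈ range M, (a (j + 1) - a j) * t ^ (j + 1) =
      a M * t ^ (M + 1) + (1 - t) * ∑ j ∈ range M, a (j + 1) * t ^ (j + 1) := by
  induction M with
  | zero => simp [h0]
  | succ M ih => rw [sum_range_succ, ih, sum_range_succ]; ring

theorem sum_range_sub_mul_sq_pow_succ_le {a : ℕ → ℝ} {t C : ℝ} (h0 : a 0 = 0) (ht : 0 ≤ t)
    (ht1 : t ≤ 1) (ha : ∀ j, a j * t ^ j ≤ C) (M : ℕ) :
    ∑ j ∈ range M, (a (j + 1) - a j) * (t ^ 2) ^ (j + 1) ≤ 2 * C := by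
  have hC : 0 ≤ C := by simpa [h0] using ha 0
  have term : ∀ j, a j * (t ^ 2) ^ j ≤ C * t ^ j := fun j =>
    calc a j * (t ^ 2) ^ j = a j * t ^ j * t ^ j := by ring
      _ ≤ C * t ^ j := by gcongr; exact ha j
  have ht2 : t ^ 2 ≤ 1 := pow_le_one₀ ht ht1
  calc _ = a M * (t ^ 2) ^ M * t ^ 2
        + (1 - t ^ 2) * ∑ j ∈ range M, a (j + 1) * (t ^ 2) ^ (j + 1) := by
        rw [sum_range_sub_mul_pow_succ h0]; ring
    _ ≤ C * t ^ M * t ^ 2 + (1 - t ^ 2) * ∑ j ∈ range M, C * t ^ (j + 1) := by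
        refine add_le_add (mul_le_mul_of_nonneg_right (term M) (sq_nonneg t)) ?_
        exact mul_le_mul_of_nonneg_left (sum_le_sum fun j _ => term (j + 1)) (by linarith)
    _ = C * t ^ M * t ^ 2 + C * t * (1 + t) * ((1 - t) * ∑ j ∈ range M, t ^ j) := by
        simp only [pow_succ, ← mul_sum, ← sum_mul]; ring
    _ = C * (t * (1 + t - t ^ M)) := by rw [mul_neg_geom_sum]; ring
    _ ≤ C * 2 := by
        gcongr
        nlinarith [pow_nonneg ht M, mul_nonneg ht (pow_nonneg ht M)]
    _ = 2 * C := mul_comm _ _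

theorem sum_range_pow_sub_mul_exp_le {φ : ℝ} (hφ : 0 < φ) {r : ℕ} (hr : r ≠ 0) (M : ℕ) :
    ∑ j ∈ range M, (((j + 1 : ℕ) : ℝ) ^ r - (j : ℝ) ^ r) *
      Real.exp (-((j + 1 : ℕ) * (2 * φ))) ≤ 2 * (r / (2 * φ)) ^ r := by
  have hexp : ∀ j : ℕ, Real.exp (-(j * (2 * φ))) = (Real.exp (-φ) ^ 2) ^ j := fun j => by
    rw [← pow_mul, ← Real.exp_nat_mul]; congr 1; push_cast; ring
  simp only [hexp]
  refine sum_range_sub_mul_sq_pow_succ_le (a := fun j : ℕ => (j : ℝ) ^ r) (by simp [hr])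
    (Real.exp_nonneg _) (Real.exp_le_one_iff.2 (by linarith)) (fun j => ?_) M
  calc (j : ℝ) ^ r * Real.exp (-φ) ^ j
      ≤ (r / (2 * φ)) ^ r * Real.exp (φ * j) * Real.exp (-φ) ^ j := by
        gcongr; exact pow_le_mul_exp hφ j.cast_nonneg r
    _ = (r / (2 * φ)) ^ r := by
        rw [mul_assoc, ← Real.exp_nat_mul, ← Real.exp_add]
        simp [mul_comm φ]

variable {S : Type*} [Fintype S] {π : S → ℝ}

theorem sum_mul_comp_eq_sum_mul_prob {f : ℕ → ℝ} (h0 : f 0 = 0) {V : S → ℕ} {M : ℕ}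
    (hV : ∀ s, V s ≤ M) :
    ∑ s, π s * f (V s) = ∑ j ∈ range M, (f (j + 1) - f j) * prob π {s | j + 1 ≤ V s} := by
  classical
  have layers : ∀ s, f (V s) = ∑ j ∈ range M, (f (j + 1) - f j) * if j + 1 ≤ V s then 1 else 0 :=
    fun s => by
      have hfilter : (range M).filter (fun j => j + 1 ≤ V s) = range (V s) := by
        ext j
        have := hV s
        simp only [mem_filter, mem_range]
        omega
      simp only [mul_ite, mul_one, mul_zero]
      rw [← sum_filter, hfilter, sum_range_sub, h0, sub_zero]
  calc ∑ s, π s * f (V s)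
      = ∑ s, ∑ j ∈ range M, (f (j + 1) - f j) * (π s * if j + 1 ≤ V s then 1 else 0) := by
        simp only [layers, mul_sum, mul_left_comm]
    _ = _ := by
        rw [sum_comm]
        simp only [← mul_sum, prob_eq_sum_mul_indicator, Set.indicator_apply, Set.mem_ofPred_eq,
          Pi.one_apply]

theorem sum_mul_pow_le_of_prob_le_exp {V : S → ℕ} {M r : ℕ} {φ β : ℝ} (hr : r ≠ 0) (hφ : 0 < φ)
    (hV : ∀ s, V s ≤ M)
    (htail : ∀ n : ℕ, prob π {s | n ≤ V s} ≤ Real.exp (-(n * (2 * φ))) + β) :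
    ∑ s, π s * (V s : ℝ) ^ r ≤ 2 * (r / (2 * φ)) ^ r + M ^ r * β := by
  have hincr : ∀ j : ℕ, 0 ≤ ((j + 1 : ℕ) : ℝ) ^ r - (j : ℝ) ^ r := fun j => by
    rw [sub_nonneg]
    gcongr
    exact j.le_succ
  have h0 : ((0 : ℕ) : ℝ) ^ r = 0 := by simp [hr]
  calc ∑ s, π s * (V s : ℝ) ^ r
      = ∑ j ∈ range M, (((j + 1 : ℕ) : ℝ) ^ r - (j : ℝ) ^ r) * prob π {s | j + 1 ≤ V s} :=
        sum_mul_comp_eq_sum_mul_prob (f := fun j : ℕ => (j : ℝ) ^ r) h0 hV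
    _ ≤ ∑ j ∈ range M, (((j + 1 : ℕ) : ℝ) ^ r - (j : ℝ) ^ r) *
          (Real.exp (-((j + 1 : ℕ) * (2 * φ))) + β) := by
        gcongr with j
        exacts [hincr j, htail (j + 1)]
    _ ≤ _ := by
        simp only [mul_add, sum_add_distrib, ← sum_mul]
        rw [sum_range_sub (fun j : ℕ => (j : ℝ) ^ r), h0, sub_zero]
        gcongr
        exact sum_range_pow_sub_mul_exp_le hφ hr M

end Moments

section Chain

attribute [local instance] Matrix.linftyOpNormedRing Matrix.linftyOpNormedAlgebra in
theorem vecMul_eq_zero_of_vecMul_exp_smul {m : Type*} [Fintype m] [DecidableEq m]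
    {A : Matrix m m ℝ} {v : m → ℝ}
    (h : ∀ t : ℝ, 0 ≤ t → Matrix.vecMul v (NormedSpace.exp (t • A)) = v) :
    Matrix.vecMul v A = 0 := by
  have hexp : HasDerivAt (fun t : ℝ => NormedSpace.exp (t • A)) A 0 := by
    have h0 := hasDerivAt_exp_smul_const (𝕂 := ℝ) A (0 : ℝ)
    rw [zero_smul, NormedSpace.exp_zero, one_mul] at h0
    exact h0
  let L : Matrix m m ℝ →ₗ[ℝ] m → ℝ :=
    { toFun := Matrix.vecMul v
      map_add' := fun M M' => Matrix.vecMul_add M M' v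
      map_smul' := fun c M => Matrix.vecMul_smul v c M }
  have hderiv : HasDerivAt (fun t : ℝ => L (NormedSpace.exp (t • A))) (L A) 0 :=
    (LinearMap.toContinuousLinearMap L).hasFDerivAt.comp_hasDerivAt (0 : ℝ) hexp
  have hconst : HasDerivWithinAt (fun t : ℝ => L (NormedSpace.exp (t • A))) 0 (Set.Ici 0) 0 :=
    (hasDerivWithinAt_const (0 : ℝ) (Set.Ici 0) v).congr_of_mem (fun t ht => h t ht) (by simp)
  exact (uniqueDiffWithinAt_Ici (0 : ℝ)).eq_deriv _ hderiv.hasDerivWithinAt hconst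

variable {N b : ℕ} {Λ : ℝ} {μ : Fin N → ℝ} {q q' : State N b}

theorem generator_mulVec (Λ : ℝ) (μ : Fin N → ℝ) (f : State N b → ℝ) (q : State N b) :
    (generator Λ μ).mulVec f q = gen (rate Λ μ) f q := by
  have off_diag : ∀ q' ∈ univ.erase q, generator Λ μ q q' * f q' = rate Λ μ q q' * f q' :=
    fun q' hq' => by simp [generator, (ne_of_mem_erase hq').symm]
  rw [gen, Matrix.mulVec, dotProduct, ← add_sum_erase _ _ (mem_univ q),
    ← add_sum_erase (a := q) univ (fun q' => rate Λ μ q q' * (f q' - f q)) (mem_univ q),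
    sum_congr rfl off_diag]
  simp only [generator, Matrix.of_apply, if_true, mul_sub, sum_sub_distrib, ← sum_mul]
  ring

theorem IsSteadyState.isInvariant {π : State N b → ℝ} (hπ : IsSteadyState Λ μ π) :
    IsInvariant (rate Λ μ) π where
  mem_stdSimplex := hπ.1
  sum_mul_gen f := by
    have h : π ⬝ᵥ (generator Λ μ).mulVec f = 0 := by
      rw [Matrix.dotProduct_mulVec, vecMul_eq_zero_of_vecMul_exp_smul hπ.2, zero_dotProduct]
    simpa only [dotProduct, generator_mulVec] using h

theorem mem_fastestShortest {n : Fin N} : n ∈ fastestShortest μ q ↔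
    (∀ m, q n ≤ q m) ∧ ∀ m, (∀ l, q m ≤ q l) → μ m ≤ μ n := by
  simp [fastestShortest]

theorem fastestShortest_nonempty (hN : 0 < N) (μ : Fin N → ℝ) (q : State N b) :
    (fastestShortest μ q).Nonempty := by
  classical
  have : Nonempty (Fin N) := ⟨⟨0, hN⟩⟩
  obtain ⟨n₀, -, h₀⟩ := exists_min_image univ q univ_nonempty
  obtain ⟨n, hn, h⟩ := exists_max_image {n | ∀ m, q n ≤ q m} μ ⟨n₀, by simpa using h₀⟩
  exact ⟨n, mem_fastestShortest.2 (by simpa using And.intro hn h)⟩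

theorem routeProb_nonneg (μ : Fin N → ℝ) (q : State N b) (n : Fin N) : 0 ≤ routeProb μ q n := by
  unfold routeProb
  split_ifs <;> positivity

theorem sum_routeProb (hN : 0 < N) (μ : Fin N → ℝ) (q : State N b) :
    ∑ n, routeProb μ q n = 1 := by
  classical
  have hcard : ((fastestShortest μ q).card : ℝ) ≠ 0 := by
    exact_mod_cast (fastestShortest_nonempty hN μ q).card_pos.ne'
  unfold routeProb
  rw [sum_ite_mem, univ_inter, sum_const, nsmul_eq_mul, mul_one_div_cancel hcard]

theorem rate_nonneg (hΛ : 0 ≤ Λ) (hμ : ∀ n, 0 ≤ μ n) (q q' : State N b) : 0 ≤ rate Λ μ q q' :=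
  add_nonneg
    (sum_nonneg fun n _ => ite_nonneg (mul_nonneg hΛ (routeProb_nonneg μ q n)) le_rfl)
    (sum_nonneg fun n _ => ite_nonneg (hμ n) le_rfl)

theorem exists_arrive_or_depart_of_rate_ne_zero (h : rate Λ μ q q' ≠ 0) :
    (∃ n ∈ fastestShortest μ q, arrive q n = q') ∨ ∃ n, depart q n = q' := by
  contrapose! h
  unfold rate
  rw [sum_eq_zero fun n _ => ?_, sum_eq_zero fun n _ => if_neg (h.2 n), add_zero]
  by_cases hn : n ∈ fastestShortest μ q
  · exact if_neg (h.1 n hn)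
  · simp [routeProb, hn]

theorem sum_rate_mul (Λ : ℝ) (μ : Fin N → ℝ) (q : State N b) (g : State N b → ℝ) :
    ∑ q', rate Λ μ q q' * g q' =
      Λ * ∑ n, routeProb μ q n * g (arrive q n) + ∑ n, μ n * g (depart q n) := by
  simp only [rate, add_mul, sum_add_distrib, sum_mul, mul_sum]
  rw [sum_comm, sum_comm (f := fun q' n => (if depart q n = q' then μ n else 0) * g q')]
  simp [ite_mul, mul_assoc]

theorem sum_rate_mul_le (hN : 0 < N) (hΛ : 0 ≤ Λ) (hμ : ∀ n, 0 ≤ μ n) {g : State N b → ℝ} {a : ℝ}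
    {d : Fin N → ℝ} (ha : ∀ n ∈ fastestShortest μ q, g (arrive q n) ≤ a)
    (hd : ∀ n, g (depart q n) ≤ d n) :
    ∑ q', rate Λ μ q q' * g q' ≤ Λ * a + ∑ n, μ n * d n := by
  have route : ∑ n, routeProb μ q n * g (arrive q n) ≤ ∑ n, routeProb μ q n * a :=
    sum_le_sum fun n _ => by
      by_cases hn : n ∈ fastestShortest μ q
      · exact mul_le_mul_of_nonneg_left (ha n hn) (routeProb_nonneg μ q n)
      · simp [routeProb, hn]
  rw [← sum_mul, sum_routeProb hN, one_mul] at route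
  rw [sum_rate_mul]
  gcongr with n
  exacts [hμ n, hd n]

theorem gen_intCast_le (hN : 0 < N) (hΛ : 0 ≤ Λ) (hμ : ∀ n, 0 ≤ μ n) {V : State N b → ℤ} {a : ℤ}
    {d : Fin N → ℤ} (ha : ∀ n ∈ fastestShortest μ q, V (arrive q n) ≤ V q + a)
    (hd : ∀ n, V (depart q n) ≤ V q + d n) :
    gen (rate Λ μ) (fun q => (V q : ℝ)) q ≤ Λ * a + ∑ n, μ n * d n := by
  have ha' : ∀ n ∈ fastestShortest μ q, (V (arrive q n) : ℝ) ≤ V q + a := mod_cast ha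
  have hd' : ∀ n, (V (depart q n) : ℝ) ≤ V q + d n := mod_cast hd
  exact sum_rate_mul_le hN hΛ hμ (fun n hn => sub_le_iff_le_add'.2 (ha' n hn))
    fun n => sub_le_iff_le_add'.2 (hd' n)

theorem idle_of_mem_fastestShortest {m n : Fin N} (hm : (q m : ℕ) = 0)
    (hn : n ∈ fastestShortest μ q) : (q n : ℕ) = 0 ∧ μ m ≤ μ n := by
  have hn := mem_fastestShortest.1 hn
  have hle : (q n : ℕ) ≤ q m := hn.1 m
  exact ⟨by omega, hn.2 m fun l => by rw [Fin.le_def]; omega⟩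

end Chain

section Counts

variable {N b : ℕ} {μ : Fin N → ℝ}

/-- The number of busy servers in `G`. -/
def busy (G : Finset (Fin N)) (q : State N b) : ℤ := ∑ n ∈ G, if (q n : ℕ) = 0 then 0 else 1

/-- The number of waiting jobs, that is of jobs that are in the system but not in service. -/
def waiting (q : State N b) : ℤ := ∑ n, (((q n : ℕ) - 1 : ℕ) : ℤ)

/-- The number of jobs in the system. -/
def total (q : State N b) : ℤ := ∑ n, ((q n : ℕ) : ℤ)

/-- The total service rate of the servers whose queue length satisfies `p`. -/
noncomputable def serviceRate (μ : Fin N → ℝ) (p : ℕ → Prop) [DecidablePred p]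
    (q : State N b) : ℝ :=
  ∑ n with p (q n), μ n

theorem sum_comp_update (G : Finset (Fin N)) (g : ℕ → ℤ) (q : State N b) (n : Fin N)
    (v : Fin (b + 1)) :
    ∑ m ∈ G, g (Function.update q n v m) =
      ∑ m ∈ G, g (q m) + if n ∈ G then g v - g (q n) else 0 := by
  rw [← sub_eq_iff_eq_add', ← sum_sub_distrib,
    sum_congr rfl (g := fun m => if m = n then g v - g (q n) else 0) fun m _ => ?_]
  · simp
  · rcases eq_or_ne m n with rfl | h <;> simp [*]

theorem busy_arrive (hb : 0 < b) (G : Finset (Fin N)) (q : State N b) (n : Fin N) :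
    busy G (arrive q n) = busy G q + if n ∈ G ∧ (q n : ℕ) = 0 then 1 else 0 := by
  rw [busy, arrive, sum_comp_update G (fun k => if k = 0 then 0 else 1), busy]
  dsimp only
  split_ifs <;> grind

theorem busy_depart (G : Finset (Fin N)) (q : State N b) (n : Fin N) :
    busy G (depart q n) = busy G q - if n ∈ G ∧ (q n : ℕ) = 1 then 1 else 0 := by
  rw [busy, depart, sum_comp_update G (fun k => if k = 0 then 0 else 1), busy]
  dsimp only
  split_ifs <;> grind

theorem waiting_arrive (hb : 0 < b) (q : State N b) (n : Fin N) :
    waiting (arrive q n) = waiting q + if 1 ≤ (q n : ℕ) ∧ (q n : ℕ) < b then 1 else 0 := by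
  rw [waiting, arrive, sum_comp_update univ (fun k => ((k - 1 : ℕ) : ℤ)), waiting]
  have := (q n).2
  dsimp only
  split_ifs <;> grind

theorem waiting_depart (q : State N b) (n : Fin N) :
    waiting (depart q n) = waiting q - if 2 ≤ (q n : ℕ) then 1 else 0 := by
  rw [waiting, depart, sum_comp_update univ (fun k => ((k - 1 : ℕ) : ℤ)), waiting]
  dsimp only
  split_ifs <;> grind

theorem total_arrive (q : State N b) (n : Fin N) :
    total (arrive q n) = total q + if (q n : ℕ) < b then 1 else 0 := by
  rw [total, arrive, sum_comp_update univ (fun k => (k : ℤ)), total]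
  have := (q n).2
  dsimp only
  split_ifs <;> grind

theorem total_depart (q : State N b) (n : Fin N) :
    total (depart q n) = total q - if 1 ≤ (q n : ℕ) then 1 else 0 := by
  rw [total, depart, sum_comp_update univ (fun k => (k : ℤ)), total]
  dsimp only
  split_ifs <;> grind

theorem total_eq_busy_add_waiting (q : State N b) : total q = busy univ q + waiting q := by
  rw [total, busy, waiting, ← sum_add_distrib]
  refine sum_congr rfl fun n _ => ?_
  split_ifs <;> omega

theorem total_le (q : State N b) : total q ≤ b * N := by
  calc total q ≤ ∑ _n : Fin N, (b : ℤ) := sum_le_sum fun n _ => by have := (q n).2; omega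
    _ = b * N := by simp [mul_comm]

theorem avgQueue_eq_total_div (q : State N b) : avgQueue q = (total q : ℝ) / N := by
  rw [avgQueue, total, one_div_mul_eq_div]
  push_cast
  rfl

theorem busy_nonneg (G : Finset (Fin N)) (q : State N b) : 0 ≤ busy G q :=
  sum_nonneg fun _ _ => by split_ifs <;> simp

theorem busy_le_card (G : Finset (Fin N)) (q : State N b) : busy G q ≤ G.card := by
  rw [busy, ← mul_one (G.card : ℤ), ← nsmul_eq_mul, ← sum_const]
  exact sum_le_sum fun _ _ => by split_ifs <;> simp

theorem busy_univ_le (q : State N b) : busy univ q ≤ N := by simpa using busy_le_card univ q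

theorem exists_idle_of_busy_lt_card {G : Finset (Fin N)} {q : State N b}
    (h : busy G q < G.card) : ∃ n ∈ G, (q n : ℕ) = 0 := by
  contrapose! h
  rw [busy, sum_congr rfl fun n hn => if_neg (h n hn)]
  simp

theorem sum_mul_ite_eq_mul_serviceRate (μ : Fin N → ℝ) (p : ℕ → Prop) [DecidablePred p]
    (c : ℝ) (q : State N b) :
    ∑ n, μ n * (if p (q n) then c else 0) = c * serviceRate μ p q := by
  rw [serviceRate, mul_sum, sum_filter]
  exact sum_congr rfl fun n _ => by split_ifs <;> ring

theorem serviceRate_le_sum (hμ : ∀ n, 0 ≤ μ n) (p : ℕ → Prop) [DecidablePred p] (q : State N b) :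
    serviceRate μ p q ≤ ∑ n, μ n :=
  sum_le_sum_of_subset_of_nonneg (filter_subset _ _) fun n _ _ => hμ n

theorem serviceRate_one_add_serviceRate_ge_two (μ : Fin N → ℝ) (q : State N b) :
    serviceRate μ (· = 1) q + serviceRate μ (2 ≤ ·) q = serviceRate μ (1 ≤ ·) q := by
  rw [serviceRate, serviceRate, serviceRate, ← sum_union
    (disjoint_filter.2 fun _ _ h => by omega), ← filter_or]
  congr! 2
  omega

theorem mul_waiting_le {ε : ℝ} (hε : 0 ≤ ε) (hμ : ∀ n, ε ≤ μ n) (q : State N b) :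
    ε * waiting q ≤ ((b : ℝ) - 1) * serviceRate μ (2 ≤ ·) q := by
  rw [serviceRate, sum_filter, waiting]
  push_cast
  rw [mul_sum, mul_sum]
  refine sum_le_sum fun n _ => ?_
  split_ifs with h
  · have hq : (((q n : ℕ) - 1 : ℕ) : ℝ) ≤ (b : ℝ) - 1 := by
      have : ((q n : ℕ) : ℝ) ≤ b := by exact_mod_cast (by omega)
      rw [Nat.cast_pred (by omega)]
      linarith
    rw [mul_comm]
    exact mul_le_mul hq (hμ n) hε ((Nat.cast_nonneg _).trans hq)
  · simp [show (q n : ℕ) - 1 = 0 by omega]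

theorem sum_sub_serviceRate_le {c : ℝ} (hμ : ∀ n, μ n ≤ c) (q : State N b) :
    ∑ n, μ n - serviceRate μ (1 ≤ ·) q ≤ c * (N - busy univ q) := by
  have hN : (N : ℝ) = ∑ _n : Fin N, (1 : ℝ) := by simp
  rw [serviceRate, sum_filter, busy, hN]
  push_cast
  rw [← sum_sub_distrib, ← sum_sub_distrib, mul_sum]
  refine sum_le_sum fun n _ => ?_
  rcases Nat.eq_zero_or_pos (q n : ℕ) with h | h
  · simpa [h] using hμ n
  · simp [h.ne', Nat.one_le_iff_ne_zero]

theorem one_le_of_sum_eq {c : ℝ} (hN : 0 < N) (hμ : ∀ n, μ n ≤ c) (hsum : ∑ n, μ n = N) :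
    1 ≤ c := by
  have h := sum_le_card_nsmul univ μ c fun n _ => hμ n
  rw [hsum, card_fin, nsmul_eq_mul] at h
  exact le_of_mul_le_mul_left (by simpa using h) (Nat.cast_pos.2 hN)

theorem le_one_of_sum_eq {c : ℝ} (hN : 0 < N) (hμ : ∀ n, c ≤ μ n) (hsum : ∑ n, μ n = N) :
    c ≤ 1 := by
  have h := card_nsmul_le_sum univ μ c fun n _ => hμ n
  rw [hsum, card_fin, nsmul_eq_mul] at h
  exact le_of_mul_le_mul_left (by simpa using h) (Nat.cast_pos.2 hN)

end Counts

section IdleWaiting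

variable {N b : ℕ} {Λ : ℝ} {μ : Fin N → ℝ} {π : State N b → ℝ} {q q' : State N b} {A : ℤ}

theorem idle_of_busy_univ_lt {n : Fin N} (hq : busy univ q < N) (hn : n ∈ fastestShortest μ q) :
    (q n : ℕ) = 0 := by
  obtain ⟨m, -, hm⟩ := exists_idle_of_busy_lt_card (G := univ) (q := q) (by simpa using hq)
  exact (idle_of_mem_fastestShortest hm hn).1

/-- The smaller of the number of idle servers and the excess over `A` of the number of waiting
jobs. It is large only if servers idle while many jobs wait, against which the policy drifts. -/
def idleWaiting (A : ℤ) (q : State N b) : ℤ := min ((N : ℤ) - busy univ q) (waiting q - A)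

theorem abs_idleWaiting_sub_le (hb : 0 < b) (A : ℤ) (h : rate Λ μ q q' ≠ 0) :
    |idleWaiting A q' - idleWaiting A q| ≤ 1 := by
  rw [abs_le]
  unfold idleWaiting
  obtain ⟨n, -, rfl⟩ | ⟨n, rfl⟩ := exists_arrive_or_depart_of_rate_ne_zero h
  · have hB := busy_arrive hb univ q n
    have hW := waiting_arrive hb q n
    split_ifs at hB hW <;> omega
  · have hB := busy_depart univ q n
    have hW := waiting_depart q n
    split_ifs at hB hW <;> omega

theorem idleWaiting_arrive_le (hb : 0 < b) (hq : 0 ≤ idleWaiting A q) {n : Fin N}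
    (hn : n ∈ fastestShortest μ q) : idleWaiting A (arrive q n) ≤ idleWaiting A q := by
  have hB := busy_arrive hb univ q n
  have hW := waiting_arrive hb q n
  unfold idleWaiting at hq ⊢
  simp only [mem_univ, true_and] at hB
  by_cases hidle : busy univ q < N
  · have := idle_of_busy_univ_lt hidle hn
    split_ifs at hB hW <;> omega
  · split_ifs at hB hW <;> omega

theorem idleWaiting_depart_le (A : ℤ) (q : State N b) (n : Fin N) :
    idleWaiting A (depart q n) ≤ idleWaiting A q + 1 := by
  have hB := busy_depart univ q n
  have hW := waiting_depart q n
  unfold idleWaiting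
  split_ifs at hB hW <;> omega

theorem sum_rate_mul_idleWaiting_up_le (hN : 0 < N) (hb : 0 < b) (hΛ : 0 ≤ Λ)
    (hμ : ∀ n, 0 ≤ μ n) (hq : 0 ≤ idleWaiting A q) :
    ∑ q', rate Λ μ q q' * ((max (idleWaiting A q' - idleWaiting A q) 0 : ℤ) : ℝ) ≤ ∑ n, μ n := by
  refine (sum_rate_mul_le hN hΛ hμ (a := 0) (d := fun _ => 1) (fun n hn => ?_)
    (fun n => ?_)).trans_eq (by simp)
  · have := idleWaiting_arrive_le hb hq hn
    exact_mod_cast max_le (by omega) le_rfl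
  · have := idleWaiting_depart_le A q n
    exact_mod_cast max_le (by omega) zero_le_one

theorem gen_idleWaiting_le (hN : 0 < N) (hb : 0 < b) (hΛ : 0 ≤ Λ) (hμ : ∀ n, 0 ≤ μ n)
    (hq : 0 < idleWaiting A q) :
    gen (rate Λ μ) (fun q => (idleWaiting A q : ℝ)) q ≤
      max (serviceRate μ (· = 1) q - Λ) (-serviceRate μ (2 ≤ ·) q) := by
  have arrival : ∀ n ∈ fastestShortest μ q, busy univ (arrive q n) = busy univ q + 1 ∧
      waiting (arrive q n) = waiting q := fun n hn => by
    have hidle := idle_of_busy_univ_lt (by unfold idleWaiting at hq; omega) hn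
    simp [busy_arrive hb, waiting_arrive hb, hidle]
  have departure : ∀ n, busy univ (depart q n) = busy univ q - (if (q n : ℕ) = 1 then 1 else 0) ∧
      waiting (depart q n) = waiting q - if 2 ≤ (q n : ℕ) then 1 else 0 := fun n => by
    simp [busy_depart, waiting_depart]
  rcases le_or_gt ((N : ℤ) - busy univ q) (waiting q - A) with hmin | hmin
  · refine le_max_of_le_left ((gen_intCast_le hN hΛ hμ (a := -1)
      (d := fun n => if (q n : ℕ) = 1 then 1 else 0) (fun n hn => ?_) (fun n => ?_)).trans_eq ?_)
    · have := arrival n hn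
      unfold idleWaiting
      omega
    · have := departure n
      unfold idleWaiting
      split_ifs at this ⊢ <;> omega
    · push_cast
      rw [sum_mul_ite_eq_mul_serviceRate μ (· = 1)]
      ring
  · refine le_max_of_le_right ((gen_intCast_le hN hΛ hμ (a := 0)
      (d := fun n => if 2 ≤ (q n : ℕ) then -1 else 0) (fun n hn => ?_) (fun n => ?_)).trans_eq ?_)
    · have := arrival n hn
      unfold idleWaiting
      omega
    · have := departure n
      unfold idleWaiting
      split_ifs at this ⊢ <;> omega
    · push_cast
      rw [sum_mul_ite_eq_mul_serviceRate μ (2 ≤ ·)]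
      ring

theorem prob_idleWaiting_le (hN : 0 < N) (hb : 2 ≤ b) {ε γ : ℝ} (hΛ : 0 ≤ Λ) (hΛN : Λ ≤ N)
    (hε : 0 < ε) (hμ : ∀ n, ε ≤ μ n) (hsum : ∑ n, μ n = N) (hπ : IsSteadyState Λ μ π)
    (hγ : 0 < γ) (hA : ((b : ℝ) - 1) * (γ + (N - Λ)) ≤ ε * (A + 1)) (n : ℕ) :
    prob π {q | (n : ℤ) ≤ idleWaiting A q} ≤ Real.exp (-(n * (γ / (N + γ)))) := by
  have hb0 : 0 < b := by omega
  have hb1 : (0 : ℝ) < (b : ℝ) - 1 := sub_pos.2 (by exact_mod_cast hb)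
  have hμ0 : ∀ n, 0 ≤ μ n := fun n => hε.le.trans (hμ n)
  have tail := prob_le_exp_of_drift_int (bad := ∅) (c := 0) (rate_nonneg hΛ hμ0) hπ.isInvariant
    (hsum ▸ sum_nonneg fun n _ => hμ0 n) hγ (fun q q' => abs_idleWaiting_sub_le hb0 A)
    (fun q hq => (sum_rate_mul_idleWaiting_up_le hN hb0 hΛ hμ0 hq).trans_eq hsum)
    (fun q hq _ => ?_) n
  · simpa only [zero_add, prob_empty, zero_mul, add_zero] using tail
  · have many_waiting : γ + (N - Λ) ≤ serviceRate μ (2 ≤ ·) q := by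
      have hW : (A : ℝ) + 1 ≤ waiting q := by
        exact_mod_cast (by unfold idleWaiting at hq; omega : A + 1 ≤ waiting q)
      refine le_of_mul_le_mul_left ?_ hb1
      calc _ ≤ ε * (A + 1) := hA
        _ ≤ ε * waiting q := by gcongr
        _ ≤ _ := mul_waiting_le hε.le hμ q
    have hsplit := serviceRate_one_add_serviceRate_ge_two μ q
    have hbusy := serviceRate_le_sum hμ0 (1 ≤ ·) q
    refine (gen_idleWaiting_le hN hb0 hΛ hμ0 hq).trans (max_le ?_ ?_) <;> linarith

end IdleWaiting

section TotalDrift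

variable {N b : ℕ} {Λ : ℝ} {μ : Fin N → ℝ} {π : State N b → ℝ} {q q' : State N b}

theorem abs_total_sub_le (h : rate Λ μ q q' ≠ 0) : |total q' - total q| ≤ 1 := by
  rw [abs_le]
  obtain ⟨n, -, rfl⟩ | ⟨n, rfl⟩ := exists_arrive_or_depart_of_rate_ne_zero h
  · rw [total_arrive]
    split_ifs <;> omega
  · rw [total_depart]
    split_ifs <;> omega

theorem sum_rate_mul_total_up_le (hN : 0 < N) (hΛ : 0 ≤ Λ) (hμ : ∀ n, 0 ≤ μ n) (q : State N b) :
    ∑ q', rate Λ μ q q' * ((max (total q' - total q) 0 : ℤ) : ℝ) ≤ Λ := by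
  refine (sum_rate_mul_le hN hΛ hμ (a := 1) (d := fun _ => 0) (fun n _ => ?_)
    (fun n => ?_)).trans_eq (by simp)
  · rw [total_arrive]
    exact_mod_cast max_le (by split_ifs <;> omega) zero_le_one
  · rw [total_depart]
    exact_mod_cast max_le (by split_ifs <;> omega) le_rfl

theorem gen_total_le (hN : 0 < N) (hΛ : 0 ≤ Λ) (hμ : ∀ n, 0 ≤ μ n) (q : State N b) :
    gen (rate Λ μ) (fun q => (total q : ℝ)) q ≤ Λ - serviceRate μ (1 ≤ ·) q := by
  refine (gen_intCast_le hN hΛ hμ (a := 1) (d := fun n => if 1 ≤ (q n : ℕ) then -1 else 0)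
    (fun n _ => ?_) (fun n => ?_)).trans_eq ?_
  · rw [total_arrive]
    split_ifs <;> omega
  · rw [total_depart]
    split_ifs <;> omega
  · push_cast
    rw [sum_mul_ite_eq_mul_serviceRate μ (1 ≤ ·)]
    ring

theorem prob_total_le (hN : 0 < N) (hΛ : 0 ≤ Λ) (hμ : ∀ n, 0 ≤ μ n) (hπ : IsSteadyState Λ μ π)
    {γ : ℝ} (hγ : 0 < γ) (c : ℤ) (n : ℕ) :
    prob π {q | c + n ≤ total q} ≤ Real.exp (-(n * (γ / (Λ + γ)))) +
      prob π {q | c < total q ∧ serviceRate μ (1 ≤ ·) q < Λ + γ} * ((Λ + γ) / γ) := by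
  refine prob_le_exp_of_drift_int (rate_nonneg hΛ hμ) hπ.isInvariant hΛ hγ
    (fun q q' => abs_total_sub_le) (fun q _ => sum_rate_mul_total_up_le hN hΛ hμ q)
    (fun q hc hq => ?_) n
  have service : Λ + γ ≤ serviceRate μ (1 ≤ ·) q := not_lt.1 fun h => hq ⟨hc, h⟩
  linarith [gen_total_le hN hΛ hμ q]

end TotalDrift

section SuperRegime

variable {N b r : ℕ} {Λ x ε μ₁ : ℝ} {μ : Fin N → ℝ} {π : State N b → ℝ} {A : ℤ}

theorem prob_slow_service_le (hN : 0 < N) (hb : 2 ≤ b) {γ y : ℝ} (hΛ : 0 ≤ Λ) (hΛN : Λ ≤ N)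
    (hε : 0 < ε) (hμ : ∀ n, ε ≤ μ n) (hμ₁ : ∀ n, μ n ≤ μ₁) (hsum : ∑ n, μ n = N)
    (hπ : IsSteadyState Λ μ π) (hγ : 0 < γ)
    (hA : ((b : ℝ) - 1) * (γ + (N - Λ)) ≤ ε * (A + 1)) :
    prob π {q | N + A < total q ∧ serviceRate μ (1 ≤ ·) q < N - y} ≤
      Real.exp (-(y / μ₁ * (γ / (N + γ)))) := by
  have hμ₁0 : 0 < μ₁ := zero_lt_one.trans_le (one_le_of_sum_eq hN hμ₁ hsum)
  calc _ ≤ prob π {q | (⌈y / μ₁⌉₊ : ℤ) ≤ idleWaiting A q} := prob_mono hπ.1 fun q hq => ?_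
    _ ≤ Real.exp (-(⌈y / μ₁⌉₊ * (γ / (N + γ)))) :=
      prob_idleWaiting_le hN hb hΛ hΛN hε hμ hsum hπ hγ hA _
    _ ≤ _ := by
      gcongr
      exact Nat.le_ceil _
  obtain ⟨jobs, slow⟩ := hq
  have idle : y / μ₁ ≤ (N : ℝ) - busy univ q := by
    rw [div_le_iff₀' hμ₁0]
    linarith [sum_sub_serviceRate_le hμ₁ q]
  lift (N : ℤ) - busy univ q to ℕ using sub_nonneg.2 (busy_univ_le q) with i hi
  have hi' : (i : ℝ) = N - busy univ q := by exact_mod_cast hi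
  have hceil : ⌈y / μ₁⌉₊ ≤ i := Nat.ceil_le.2 (hi' ▸ idle)
  have := total_eq_busy_add_waiting q
  simp only [Set.mem_ofPred_eq, idleWaiting]
  omega

theorem exp_neg_natCast_mul_log {x : ℝ} (hx : 0 < x) (k : ℕ) :
    Real.exp (-(k * Real.log x)) = 1 / x ^ k := by
  rw [Real.exp_neg, Real.exp_nat_mul, Real.exp_log hx, one_div]

section

variable (hN : 0 < N) (hb : 2 ≤ b) (hr : 0 < r) (hε : 0 < ε) (hμ : ∀ n, ε ≤ μ n)
  (hμ₁ : ∀ n, μ n ≤ μ₁) (hsum : ∑ n, μ n = N) (hx : 0 < x) (hxN : x ≤ N)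
  (hπ : IsSteadyState ((N : ℝ) - x) μ π) (hlog : 0 < Real.log N)
  (hγN : 8 * r * μ₁ * Real.log N ≤ x) (hγx : x ^ 2 ≤ 16 * r * μ₁ * N * Real.log N)
  (hA : 24 * r * ((b : ℝ) - 1) * μ₁ / ε * Real.log N / x * N ≤ A + 1)

include hN hb hr hε hμ hμ₁ hsum hx hxN hπ hlog hγN hγx hA

theorem prob_slow_service_le_exp :
    prob π {q | N + A < total q ∧ serviceRate μ (1 ≤ ·) q < N - x / 2} ≤
      Real.exp (-(2 * r * Real.log N)) := by
  have hNR : (0 : ℝ) < N := Nat.cast_pos.2 hN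
  have hμ₁0 : 0 < μ₁ := zero_lt_one.trans_le (one_le_of_sum_eq hN hμ₁ hsum)
  have hb1 : (0 : ℝ) < (b : ℝ) - 1 := sub_pos.2 (by exact_mod_cast hb)
  set γ := 8 * r * μ₁ * N * Real.log N / x with hγ
  have x_le : x ≤ 2 * γ := by
    rw [hγ, mul_div_assoc', le_div_iff₀ hx]
    linarith
  have γ_le : γ ≤ N := by
    rw [hγ, div_le_iff₀ hx]
    linarith [mul_le_mul_of_nonneg_right hγN hNR.le]
  refine (prob_slow_service_le hN hb (sub_nonneg.2 hxN) (sub_le_self _ hx.le) hε hμ hμ₁ hsum hπ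
    (γ := γ) (by positivity) ?_).trans ?_
  · calc ((b : ℝ) - 1) * (γ + (N - (N - x))) ≤ ((b : ℝ) - 1) * (3 * γ) := by
          gcongr
          linarith
      _ = ε * (24 * r * ((b : ℝ) - 1) * μ₁ / ε * Real.log N / x * N) := by
        rw [hγ]
        field_simp
        ring
      _ ≤ ε * (A + 1) := by gcongr
  · rw [Real.exp_le_exp, neg_le_neg_iff]
    calc 2 * r * Real.log N = x / 2 / μ₁ * (γ / (N + N)) := by
          rw [hγ]
          field_simp
          ring
      _ ≤ x / 2 / μ₁ * (γ / (N + γ)) := by gcongr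

theorem prob_total_le_super (n : ℕ) :
    prob π {q | N + A + n ≤ total q} ≤
      Real.exp (-(n * (2 * (x / (4 * N))))) + 1 / (N : ℝ) ^ (2 * r) * (2 * N / x) := by
  have hNR : (0 : ℝ) < N := Nat.cast_pos.2 hN
  have slow := prob_slow_service_le_exp hN hb hr hε hμ hμ₁ hsum hx hxN hπ hlog hγN hγx hA
  rw [show 2 * (r : ℝ) * Real.log N = ((2 * r : ℕ) : ℝ) * Real.log N by push_cast; ring,
    exp_neg_natCast_mul_log hNR] at slow
  have tail := prob_total_le hN (sub_nonneg.2 hxN) (fun n => hε.le.trans (hμ n)) hπ (half_pos hx)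
    (N + A) n
  have hhalf : (N : ℝ) - x + x / 2 = N - x / 2 := by ring
  have hle : (N : ℝ) - x / 2 ≤ N := by linarith
  have hpos : 0 < (N : ℝ) - x / 2 := by linarith
  rw [hhalf] at tail
  calc _ ≤ _ := tail
    _ ≤ Real.exp (-(n * (x / 2 / N))) + 1 / (N : ℝ) ^ (2 * r) * (N / (x / 2)) := by gcongr
    _ = _ := by
      rw [show x / 2 / N = 2 * (x / (4 * N)) by field_simp; norm_num,
        show N / (x / 2) = 2 * N / x by field_simp]

theorem sum_mul_total_excess_pow_le (hx2 : 2 ≤ x) (hbx : b * x ≤ N) (hA0 : 0 ≤ A) :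
    ∑ q, π q * ((total q - (N + A)).toNat : ℝ) ^ r ≤ 10 * (2 * r * N / x) ^ r := by
  have hNR : (1 : ℝ) ≤ N := by exact_mod_cast hN
  have hrR : (1 : ℝ) ≤ r := by exact_mod_cast hr
  have level : ∀ n : ℕ, prob π {q | n ≤ (total q - (N + A)).toNat} ≤
      Real.exp (-(n * (2 * (x / (4 * N))))) + 1 / (N : ℝ) ^ (2 * r) * (2 * N / x) := fun n => by
    rcases n.eq_zero_or_pos with rfl | hn
    · refine (prob_le_one hπ.1 _).trans ?_
      simp only [Nat.cast_zero, zero_mul, neg_zero, Real.exp_zero]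
      exact le_add_of_nonneg_right (by positivity)
    · refine (prob_mono hπ.1 fun q hq => ?_).trans (prob_total_le_super hN hb hr hε hμ hμ₁ hsum hx
        hxN hπ hlog hγN hγx hA n)
      simp only [Set.mem_ofPred_eq] at hq ⊢
      omega
  have excess_le : ∀ q : State N b, (total q - (N + A)).toNat ≤ b * N := fun q =>
    Int.toNat_le.2 (by have := total_le q; push_cast; omega)
  have moment := sum_mul_pow_le_of_prob_le_exp hr.ne' (by positivity) excess_le level
  have rare : ((b * N : ℕ) : ℝ) ^ r * (1 / (N : ℝ) ^ (2 * r) * (2 * N / x)) ≤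
      (2 * r * N / x) ^ r := by
    have hbN : ((b * N : ℕ) : ℝ) ≤ N * (N / x) := by
      push_cast
      rw [← mul_div_assoc, le_div_iff₀ hx, mul_right_comm]
      gcongr
    have hN_pow : 2 * N / x ≤ (N : ℝ) ^ r :=
      calc 2 * N / x ≤ N := by rw [div_le_iff₀ hx]; nlinarith
        _ ≤ _ := le_self_pow₀ hNR hr.ne'
    calc _ ≤ (N * (N / x)) ^ r * (1 / (N : ℝ) ^ (2 * r) * (N : ℝ) ^ r) := by gcongr
      _ = (1 * N / x) ^ r := by
        rw [mul_pow, two_mul, pow_add, one_mul]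
        field_simp
      _ ≤ _ := by
        gcongr
        linarith
  have hbase : (r : ℝ) / (2 * (x / (4 * N))) = 2 * r * N / x := by field_simp; norm_num
  rw [hbase] at moment
  linarith [pow_nonneg (by positivity : 0 ≤ 2 * r * N / x) r]

end

theorem expect_avgQueue_excess_pow_le (hN : 0 < N) (hπ : π ∈ stdSimplex ℝ (State N b)) (K : ℝ)
    (r : ℕ) :
    expect π (fun q => max (avgQueue q - 1 - K) 0 ^ r) ≤
      (1 / (N : ℝ) ^ r) * ∑ q, π q * ((total q - (N + ⌊K * N⌋)).toNat : ℝ) ^ r := by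
  have hNR : (0 : ℝ) < N := Nat.cast_pos.2 hN
  rw [expect, mul_sum]
  refine sum_le_sum fun q _ => ?_
  rw [mul_left_comm, ← one_div_pow, ← mul_pow]
  refine mul_le_mul_of_nonneg_left
    (pow_le_pow_left₀ (le_max_right _ _) (max_le ?_ (by positivity)) r) (hπ.1 q)
  rw [avgQueue_eq_total_div, one_div_mul_eq_div, le_div_iff₀ hNR]
  calc ((total q : ℝ) / N - 1 - K) * N = total q - N - K * N := by field_simp
    _ ≤ total q - N - ⌊K * N⌋ := by gcongr; exact Int.floor_le _
    _ = ((total q - (N + ⌊K * N⌋) : ℤ) : ℝ) := by push_cast; ring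
    _ ≤ _ := by exact_mod_cast Int.self_le_toNat _

theorem log_natCast_ge (hN : 2 ≤ N) : 0.69 ≤ Real.log N := by
  have := Real.log_le_log (by norm_num) (by exact_mod_cast hN : (2 : ℝ) ≤ N)
  linarith [Real.log_two_gt_d9]

theorem super_parameter_bounds {b r ℓ : ℝ} (hb : 2 ≤ b) (hr : 1 ≤ r) (hμ₁ : 1 ≤ μ₁)
    (hℓ : 0.69 ≤ ℓ) (hx : 24 * r * b * ℓ ^ 2 * μ₁ ≤ x) : b ≤ x ∧ 8 * r * μ₁ * ℓ ≤ x := by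
  have hrμ : 1 ≤ r * μ₁ := one_le_mul_of_one_le_of_one_le hr hμ₁
  have hℓ2 : 0.69 * ℓ ≤ ℓ ^ 2 := by nlinarith
  constructor <;> refine le_trans ?_ hx
  · calc b = b * (1 * 1) := by ring
      _ ≤ b * (24 * ℓ ^ 2 * (r * μ₁)) := by gcongr; linarith
      _ = _ := by ring
  · calc 8 * r * μ₁ * ℓ = r * μ₁ * (8 * ℓ) := by ring
      _ ≤ r * μ₁ * (24 * b * ℓ ^ 2) := by
        refine mul_le_mul_of_nonneg_left ?_ (by positivity)
        nlinarith
      _ = _ := by ring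

theorem expect_le_of_sq_le (hN : 2 ≤ N) (hb : 2 ≤ b) (hr : 0 < r) (hε : 0 < ε)
    (hμ : ∀ n, ε ≤ μ n) (hμ₁ : ∀ n, μ n ≤ μ₁) (hsum : ∑ n, μ n = N) (hx : 0 < x)
    (hxN : x ^ 2 ≤ N) (hπ : IsSteadyState ((N : ℝ) - x) μ π)
    (hcond : μ₁ / ε ≤ x / (24 * r * b * Real.log N ^ 2)) :
    expect π (fun q => max (avgQueue q - 1 - kSuper b r ε μ₁ * Real.log N / x) 0 ^ r) ≤
      10 * (2 * r / x) ^ r := by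
  have hN0 : 0 < N := by omega
  have hNR : (0 : ℝ) < N := Nat.cast_pos.2 hN0
  have hrR : (1 : ℝ) ≤ r := by exact_mod_cast hr
  have hbR : (2 : ℝ) ≤ b := by exact_mod_cast hb
  have hμ₁1 := one_le_of_sum_eq hN0 hμ₁ hsum
  have hlog := log_natCast_ge hN
  have hlog0 : 0 < Real.log N := by linarith
  have capacity : 24 * r * b * Real.log N ^ 2 * μ₁ ≤ x := by
    rw [div_le_div_iff₀ hε (by positivity)] at hcond
    linarith [mul_le_of_le_one_right hx.le (le_one_of_sum_eq hN0 hμ hsum)]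
  obtain ⟨hbx, hγN⟩ := super_parameter_bounds hbR hrR hμ₁1 hlog capacity
  have hγx : x ^ 2 ≤ 16 * r * μ₁ * N * Real.log N :=
    calc x ^ 2 ≤ 1 * N := by linarith
      _ ≤ 16 * (r * μ₁) * Real.log N * N := by
        gcongr
        nlinarith [one_le_mul_of_one_le_of_one_le hrR hμ₁1]
      _ = _ := by ring
  have hK : 0 ≤ kSuper b r ε μ₁ * Real.log N / x := by
    have : (0 : ℝ) ≤ (b : ℝ) - 1 := by linarith
    unfold kSuper
    positivity
  calc _ ≤ _ := expect_avgQueue_excess_pow_le hN0 hπ.1 _ r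
    _ ≤ (1 / (N : ℝ) ^ r) * (10 * (2 * r * N / x) ^ r) := by
      gcongr
      exact sum_mul_total_excess_pow_le hN0 hb hr hε hμ hμ₁ hsum hx (by nlinarith) hπ hlog0 hγN hγx
        (Int.lt_floor_add_one _).le (hbR.trans hbx) (by nlinarith)
        (Int.floor_nonneg.2 (by positivity))
    _ = _ := by
      rw [← one_div_pow, mul_left_comm, ← mul_pow]
      congr 2
      field_simp

end SuperRegime

section Deficit

variable {N b : ℕ} {Λ : ℝ} {μ : Fin N → ℝ} {π : State N b → ℝ} {q q' : State N b} {i t : Fin N}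

/-- The set of servers with service rate at least `y`. -/
noncomputable def fasterServers (μ : Fin N → ℝ) (y : ℝ) : Finset (Fin N) := {n | y ≤ μ n}

/-- How many busy servers are missing from those at least as fast as server `i`, relative to a
state in which the servers `0, …, i` are the busy ones. -/
noncomputable def deficit (μ : Fin N → ℝ) (i : Fin N) (q : State N b) : ℤ :=
  (i : ℕ) + 1 - busy (fasterServers μ (μ i)) q

theorem mem_fasterServers {y : ℝ} {n : Fin N} : n ∈ fasterServers μ y ↔ y ≤ μ n := by
  simp [fasterServers]

theorem Iic_subset_fasterServers (hμ : Antitone μ) (i : Fin N) :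
    Iic i ⊆ fasterServers μ (μ i) :=
  fun _ hn => mem_fasterServers.2 (hμ (mem_Iic.1 hn))

theorem sum_busy_fasterServers_le (hμ : Antitone μ) (i : Fin N) (q : State N b) :
    ∑ n ∈ fasterServers μ (μ i), (if (q n : ℕ) = 0 then 0 else μ n) ≤
      ∑ n ∈ Iic i, μ n - μ i * deficit μ i q := by
  have excess : ∑ n ∈ fasterServers μ (μ i), (if (q n : ℕ) = 0 then 0 else μ n - μ i) ≤
      ∑ n ∈ Iic i, (μ n - μ i) := by
    rw [← sum_sdiff (Iic_subset_fasterServers hμ i)]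
    refine add_le_of_nonpos_of_le (sum_nonpos fun n hn => ?_) (sum_le_sum fun n hn => ?_)
    · have : μ n ≤ μ i := hμ (not_le.1 fun h => (mem_sdiff.1 hn).2 (mem_Iic.2 h)).le
      split_ifs <;> linarith
    · have : μ i ≤ μ n := hμ (mem_Iic.1 hn)
      split_ifs <;> linarith
  have split : ∑ n ∈ fasterServers μ (μ i), (if (q n : ℕ) = 0 then 0 else μ n - μ i) =
      ∑ n ∈ fasterServers μ (μ i), (if (q n : ℕ) = 0 then 0 else μ n) -
        μ i * busy (fasterServers μ (μ i)) q := by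
    rw [busy]
    push_cast
    rw [mul_sum, ← sum_sub_distrib]
    exact sum_congr rfl fun n _ => by split_ifs <;> simp
  rw [split, sum_sub_distrib, sum_const, nsmul_eq_mul, Fin.card_Iic] at excess
  rw [deficit]
  push_cast at excess ⊢
  linarith

theorem abs_deficit_sub_le (hb : 0 < b) (i : Fin N) (h : rate Λ μ q q' ≠ 0) :
    |deficit μ i q' - deficit μ i q| ≤ 1 := by
  rw [abs_le]
  unfold deficit
  obtain ⟨n, -, rfl⟩ | ⟨n, rfl⟩ := exists_arrive_or_depart_of_rate_ne_zero h
  · rw [busy_arrive hb]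
    split_ifs <;> omega
  · rw [busy_depart]
    split_ifs <;> omega

theorem sum_rate_mul_deficit_up_le (hN : 0 < N) (hb : 0 < b) (hΛ : 0 ≤ Λ) (hμ : ∀ n, 0 ≤ μ n)
    (i : Fin N) (q : State N b) :
    ∑ q', rate Λ μ q q' * ((max (deficit μ i q' - deficit μ i q) 0 : ℤ) : ℝ) ≤ ∑ n, μ n := by
  refine (sum_rate_mul_le hN hΛ hμ (a := 0) (d := fun _ => 1) (fun n _ => ?_)
    (fun n => ?_)).trans_eq (by simp)
  · have : deficit μ i (arrive q n) - deficit μ i q ≤ 0 := by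
      rw [deficit, deficit, busy_arrive hb]
      split_ifs <;> omega
    exact_mod_cast max_le this le_rfl
  · have : deficit μ i (depart q n) - deficit μ i q ≤ 1 := by
      rw [deficit, deficit, busy_depart]
      split_ifs <;> omega
    exact_mod_cast max_le this zero_le_one

theorem deficit_arrive (hb : 0 < b) (hμ : Antitone μ) (hq : 0 < deficit μ i q) {n : Fin N}
    (hn : n ∈ fastestShortest μ q) : deficit μ i (arrive q n) = deficit μ i q - 1 := by
  have hcard := card_le_card (Iic_subset_fasterServers hμ i)
  rw [Fin.card_Iic] at hcard
  obtain ⟨m, hm, hm0⟩ := exists_idle_of_busy_lt_card (G := fasterServers μ (μ i)) (q := q)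
    (by rw [deficit] at hq; omega)
  have hidle := idle_of_mem_fastestShortest hm0 hn
  have hmem : n ∈ fasterServers μ (μ i) :=
    mem_fasterServers.2 ((mem_fasterServers.1 hm).trans hidle.2)
  rw [deficit, deficit, busy_arrive hb, if_pos ⟨hmem, hidle.1⟩]
  ring

theorem gen_deficit_le (hN : 0 < N) (hb : 0 < b) (hΛ : 0 ≤ Λ) (hμ₀ : ∀ n, 0 ≤ μ n)
    (hμ : Antitone μ) (hq : 0 < deficit μ i q) :
    gen (rate Λ μ) (fun q => (deficit μ i q : ℝ)) q ≤
      ∑ n ∈ Iic i, μ n - μ i * deficit μ i q - Λ := by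
  have drift := gen_intCast_le (q := q) hN hΛ hμ₀ (V := deficit μ i) (a := -1)
    (d := fun n => if n ∈ fasterServers μ (μ i) ∧ (q n : ℕ) = 1 then 1 else 0)
    (fun n hn => (deficit_arrive hb hμ hq hn).le)
    (fun n => by rw [deficit, deficit, busy_depart]; linarith)
  have departures : ∑ n, μ n *
      ((if n ∈ fasterServers μ (μ i) ∧ (q n : ℕ) = 1 then 1 else 0 : ℤ) : ℝ) ≤
      ∑ n ∈ fasterServers μ (μ i), if (q n : ℕ) = 0 then 0 else μ n := by
    rw [← univ_inter (fasterServers μ (μ i)), ← sum_ite_mem]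
    refine sum_le_sum fun n _ => ?_
    have := hμ₀ n
    split_ifs <;> grind
  have := sum_busy_fasterServers_le hμ i q
  push_cast at drift departures
  linarith

theorem prob_deficit_gt_le (hN : 0 < N) (hb : 0 < b) (hμ₀ : ∀ n, 0 ≤ μ n) (hμ : Antitone μ)
    (hsum : ∑ n, μ n = N) (hΛ : 0 ≤ Λ) (hπ : IsSteadyState Λ μ π) {γ K L a : ℝ} (hγ : 0 < γ)
    (hK : 0 ≤ K) (hL : 0 ≤ L) (hdrift : γ ≤ Λ - ∑ n ∈ Iic i, μ n + μ i * K)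
    (ha : a * (N + γ) ≤ (L - 1) * γ) :
    prob π {q | K + L < deficit μ i q} ≤ Real.exp (-a) := by
  have tail := prob_le_exp_of_drift_int (bad := ∅) (c := (⌊K⌋₊ : ℤ)) (U := N) (γ := γ)
    (V := deficit μ i) (rate_nonneg hΛ hμ₀) hπ.isInvariant N.cast_nonneg hγ
    (fun q q' => abs_deficit_sub_le hb i)
    (fun q _ => (sum_rate_mul_deficit_up_le hN hb hΛ hμ₀ i q).trans_eq hsum)
    (fun q hq _ => ?_) ⌊L⌋₊
  · have hsub : {q : State N b | K + L < deficit μ i q} ⊆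
        {q | (⌊K⌋₊ : ℤ) + (⌊L⌋₊ : ℕ) ≤ deficit μ i q} := fun q hq => by
      have : (⌊K⌋₊ : ℝ) + ⌊L⌋₊ ≤ deficit μ i q :=
        (add_le_add (Nat.floor_le hK) (Nat.floor_le hL)).trans (Set.mem_ofPred_eq ▸ hq).le
      exact_mod_cast this
    rw [prob_empty, zero_mul, add_zero] at tail
    refine (prob_mono hπ.1 hsub).trans (tail.trans (Real.exp_le_exp.2 (neg_le_neg ?_)))
    rw [mul_div_assoc', le_div_iff₀ (by positivity)]
    exact ha.trans (mul_le_mul_of_nonneg_right (by linarith [Nat.lt_floor_add_one L]) hγ.le)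
  · have hKq : K ≤ deficit μ i q := by
      have : ((⌊K⌋₊ : ℕ) : ℝ) + 1 ≤ deficit μ i q := by exact_mod_cast hq
      linarith [Nat.lt_floor_add_one K]
    have := mul_le_mul_of_nonneg_left hKq (hμ₀ i)
    linarith [gen_deficit_le (i := i) (q := q) hN hb hΛ hμ₀ hμ (by omega)]

theorem prob_deficit_gt_sqrt_le (hN : 0 < N) (hb : 0 < b) (hμ₀ : ∀ n, 0 < μ n) (hμ : Antitone μ)
    (hsum : ∑ n, μ n = N) (hΛ : 0 ≤ Λ) (hπ : IsSteadyState Λ μ π) {R ℓ κ : ℝ}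
    (hcap : ∑ n ∈ Iic i, μ n ≤ Λ) (hR : 2 ≤ R) (hℓ : 1 ≤ ℓ) (hκ : 0 < κ)
    (hκ2 : κ ^ 2 = 8 * N * R * ℓ) (hi : 3200 * (R * ℓ) * μ i ≤ N) :
    prob π {q | κ / √(μ i) < deficit μ i q} ≤ Real.exp (-((R + 1 / 2) * ℓ)) := by
  have hs : 0 < √(μ i) := Real.sqrt_pos.2 (hμ₀ i)
  have hs2 : √(μ i) ^ 2 = μ i := Real.sq_sqrt (hμ₀ i).le
  set s := √(μ i)
  have hγ : 0 < κ * s / 2 := by positivity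
  have hγN : κ * s / 2 ≤ N / 20 := by
    refine (sq_le_sq₀ hγ.le (by positivity)).1 ?_
    calc (κ * s / 2) ^ 2 = 2 * N * (R * ℓ * μ i) := by rw [div_pow, mul_pow, hκ2, hs2]; ring
      _ ≤ (N / 20) ^ 2 := by nlinarith [N.cast_nonneg (α := ℝ)]
  have hdrift : κ * s / 2 = μ i * (κ / s / 2) := by rw [← hs2]; field_simp
  have hexp : (R + 1 / 2) * ℓ * (N + κ * s / 2) ≤ (κ / s / 2 - 1) * (κ * s / 2) := by
    have hmain : κ / s / 2 * (κ * s / 2) = 2 * N * (R * ℓ) := by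
      have : κ / s / 2 * (κ * s / 2) = κ ^ 2 / 4 := by field_simp; ring
      rw [this, hκ2]
      ring
    have hRℓ : 2 ≤ R * ℓ := by nlinarith
    have : (R + 1 / 2) * ℓ * (N + κ * s / 2) ≤ 5 / 4 * R * ℓ * (N + N / 20) := by
      gcongr
      linarith
    nlinarith [N.cast_nonneg (α := ℝ)]
  simpa only [add_halves] using prob_deficit_gt_le hN hb (fun n => (hμ₀ n).le) hμ hsum hΛ hπ hγ
    (K := κ / s / 2) (by positivity) (by positivity) (by linarith) hexp

theorem sum_Iic_add_sum_Ioi (μ : Fin N → ℝ) (i : Fin N) :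
    ∑ n ∈ Iic i, μ n + ∑ n ∈ Ioi i, μ n = ∑ n, μ n := by
  rw [← sum_union (disjoint_left.2 fun n h1 h2 => (mem_Ioi.1 h2).not_ge (mem_Iic.1 h1))]
  congr 1
  ext n
  simp [le_or_gt]

theorem card_Ioi_eq_sub (i : Fin N) : ((Ioi i).card : ℝ) = N - ((i : ℕ) + 1) := by
  rw [Fin.card_Ioi, Nat.sub_sub, Nat.cast_sub (by omega)]
  push_cast
  ring

theorem sum_Ioi_le (hμ : Antitone μ) (hsum : ∑ n, μ n = N) (i : Fin N) :
    ∑ n ∈ Ioi i, μ n ≤ N - ((i : ℕ) + 1) := by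
  rcases le_total 1 (μ i) with h | h
  · have fast := card_nsmul_le_sum (Iic i) μ 1 fun n hn => h.trans (hμ (mem_Iic.1 hn))
    rw [Fin.card_Iic, nsmul_eq_mul] at fast
    push_cast at fast
    linarith [sum_Iic_add_sum_Ioi μ i]
  · have slow := sum_le_card_nsmul (Ioi i) μ 1 fun n hn => (hμ (mem_Ioi.1 hn).le).trans h
    rwa [nsmul_eq_mul, mul_one, card_Ioi_eq_sub] at slow

theorem sum_Iic_le_of_four_le (hμ : Antitone μ) {ε : ℝ} (hε : 0 ≤ ε) (hμε : ∀ n, ε ≤ μ n)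
    (hsum : ∑ n, μ n = N) (hi : 4 ≤ μ i) : ∑ n ∈ Iic i, μ n ≤ N - 3 / 4 * (ε * N) := by
  have fast := card_nsmul_le_sum (Iic i) μ 4 fun n hn => hi.trans (hμ (mem_Iic.1 hn))
  have slow := card_nsmul_le_sum (Ioi i) μ ε fun n _ => hμε n
  have slow_nonneg : 0 ≤ ∑ n ∈ Ioi i, μ n := sum_nonneg fun n _ => hε.trans (hμε n)
  have split := sum_Iic_add_sum_Ioi μ i
  rw [nsmul_eq_mul, card_Ioi_eq_sub] at slow
  rw [nsmul_eq_mul, Fin.card_Iic] at fast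
  push_cast at fast
  have := mul_le_mul_of_nonneg_left (by linarith : ((i : ℕ) : ℝ) + 1 ≤ N / 4) hε
  linarith

theorem prob_deficit_gt_le_of_four_le (hN : 0 < N) (hb : 0 < b) (hμ : Antitone μ) {ε : ℝ}
    (hε : 0 < ε) (hμε : ∀ n, ε ≤ μ n) (hε2 : ε ≤ 1 / 2) (hsum : ∑ n, μ n = N) (hΛ : 0 ≤ Λ)
    (hπ : IsSteadyState Λ μ π) {R ℓ : ℝ} (hΛε : N - ε * N / 2 ≤ Λ) (hR : 2 ≤ R) (hℓ : 1 ≤ ℓ)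
    (hi : 4 ≤ μ i) :
    prob π {q | 7 * R * ℓ / ε < deficit μ i q} ≤ Real.exp (-((R + 1 / 2) * ℓ)) := by
  have hN0 : (0 : ℝ) < N := Nat.cast_pos.2 hN
  have hdrift : ε * N / 4 ≤ Λ - ∑ n ∈ Iic i, μ n + μ i * 0 := by
    linarith [sum_Iic_le_of_four_le hμ hε.le hμε hsum hi]
  have hexp : (R + 1 / 2) * ℓ * (N + ε * N / 4) ≤ (7 * R * ℓ / ε - 1) * (ε * N / 4) := by
    have hmain : 7 * R * ℓ / ε * (ε * N / 4) = 7 / 4 * (R * ℓ * N) := by field_simp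
    have hRℓ : 2 * N ≤ R * ℓ * N := by gcongr; nlinarith
    have hεN : ε * N ≤ N / 2 := by nlinarith
    have : (R + 1 / 2) * ℓ * (N + ε * N / 4) ≤ 5 / 4 * R * ℓ * (N + N / 8) := by
      refine mul_le_mul ?_ (by linarith) (by positivity) (by positivity)
      exact mul_le_mul_of_nonneg_right (by linarith) (by linarith)
    linarith
  simpa only [zero_add] using prob_deficit_gt_le hN hb (fun n => hε.le.trans (hμε n)) hμ hsum hΛ
    hπ (γ := ε * N / 4) (K := 0) (by positivity) le_rfl (by positivity) hdrift hexp

/-- The total service rate of the busy servers in excess of a base rate `z` per server. -/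
noncomputable def excessRate (μ : Fin N → ℝ) (z : ℝ) (q : State N b) : ℝ :=
  ∑ n, if (q n : ℕ) = 0 then 0 else max (μ n - z) 0

theorem excessRate_nonneg (μ : Fin N → ℝ) (z : ℝ) (q : State N b) : 0 ≤ excessRate μ z q :=
  sum_nonneg fun _ _ => ite_nonneg le_rfl (le_max_right _ _)

theorem excessRate_add_mul_busy_le {y z : ℝ} (hzy : z ≤ y) (q : State N b) :
    excessRate μ y q + (y - z) * busy (fasterServers μ y) q ≤ excessRate μ z q := by
  rw [excessRate, busy, fasterServers, sum_filter]
  push_cast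
  rw [mul_sum, ← sum_add_distrib]
  refine sum_le_sum fun n _ => ?_
  split_ifs with hq hy hy
  · simp
  · simp
  · rw [max_eq_left (by linarith), max_eq_left (by linarith)]
    linarith
  · rw [max_eq_right (by linarith), mul_zero, zero_add]
    exact le_max_right _ _

theorem excessRate_add_mul_busy_univ {ε : ℝ} (hμ : ∀ n, ε ≤ μ n) (q : State N b) :
    excessRate μ ε q + ε * busy univ q = serviceRate μ (1 ≤ ·) q := by
  rw [excessRate, busy, serviceRate, sum_filter]
  push_cast
  rw [mul_sum, ← sum_add_distrib]
  refine sum_congr rfl fun n _ => ?_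
  rw [max_eq_left (sub_nonneg.2 (hμ n))]
  rcases Nat.eq_zero_or_pos (q n : ℕ) with h | h
  · simp [h]
  · simp [h.ne', Nat.one_le_iff_ne_zero]

theorem sum_Iic_succ (f : Fin N → ℝ) {k : ℕ} (hk : k + 1 < N) :
    ∑ n ∈ Iic ⟨k + 1, hk⟩, f n = ∑ n ∈ Iic ⟨k, by omega⟩, f n + f ⟨k + 1, hk⟩ := by
  have : Iic (⟨k + 1, hk⟩ : Fin N) = insert ⟨k + 1, hk⟩ (Iic ⟨k, by omega⟩) := by
    ext n
    simp only [mem_Iic, mem_insert, Fin.le_def, Fin.ext_iff]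
    omega
  rw [this, sum_insert (by simp [Fin.le_def]), add_comm]

-- Summation over the level sets: between the rates `μ (k + 1)` and `μ k` the slope of the excess
-- rate is the number of busy servers of rate at least `μ k`, and `Ψ` integrates the deficits `K`.
theorem sum_Iic_sub_le_excessRate (hμ : Antitone μ) {K Ψ : ℝ → ℝ} {ε : ℝ}
    (hΨ : ∀ y z, ε ≤ z → z ≤ y → (y - z) * K y ≤ Ψ y - Ψ z) (hN : 0 < N) :
    ∀ (k : ℕ) (hk : k < N), (∀ i ≤ (⟨k, hk⟩ : Fin N), deficit μ i q ≤ K (μ i)) →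
      ∀ z, ε ≤ z → z ≤ μ ⟨k, hk⟩ →
        ∑ n ∈ Iic ⟨k, hk⟩, (μ n - z) - (Ψ (μ ⟨0, hN⟩) - Ψ z) ≤ excessRate μ z q := by
  have level : ∀ i z, deficit μ i q ≤ K (μ i) → ε ≤ z → z ≤ μ i →
      excessRate μ (μ i) q + (μ i - z) * ((i : ℕ) + 1) - (Ψ (μ i) - Ψ z) ≤ excessRate μ z q := by
    intro i z hi hz hzi
    have hK := mul_le_mul_of_nonneg_left hi (sub_nonneg.2 hzi)
    rw [deficit] at hK
    push_cast at hK
    linarith [hΨ (μ i) z hz hzi, excessRate_add_mul_busy_le (μ := μ) hzi q]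
  intro k
  induction k with
  | zero =>
    intro hk hq z hz hzk
    have hIic : Iic (⟨0, hk⟩ : Fin N) = {⟨0, hk⟩} := by
      ext n
      simp [Fin.le_def, Fin.ext_iff]
    have := level ⟨0, hk⟩ z (hq _ le_rfl) hz hzk
    rw [hIic, sum_singleton]
    simp only [Nat.cast_zero, zero_add, mul_one] at this
    linarith [excessRate_nonneg μ (μ ⟨0, hk⟩) q]
  | succ k ih =>
    intro hk hq z hz hzk
    have previous := ih (by omega) (fun i hi => hq i (hi.trans (by simp [Fin.le_def])))
      (μ ⟨k + 1, hk⟩) (hz.trans hzk) (hμ (by simp [Fin.le_def]))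
    have last := level ⟨k + 1, hk⟩ z (hq _ le_rfl) hz hzk
    rw [sum_Iic_succ]
    simp only [sum_sub_distrib, sum_const, Fin.card_Iic, nsmul_eq_mul] at previous ⊢
    push_cast at previous last ⊢
    linarith

theorem le_serviceRate_of_deficit_le (hμ : Antitone μ) {K Ψ : ℝ → ℝ} {ε : ℝ} (hμε : ∀ n, ε ≤ μ n)
    (hΨ : ∀ y z, ε ≤ z → z ≤ y → (y - z) * K y ≤ Ψ y - Ψ z) (hN : 0 < N)
    (hq : ∀ i ≤ t, deficit μ i q ≤ K (μ i)) :
    ∑ n ∈ Iic t, μ n + ε * (busy univ q - ((t : ℕ) + 1)) - (Ψ (μ ⟨0, hN⟩) - Ψ ε) ≤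
      serviceRate μ (1 ≤ ·) q := by
  have := sum_Iic_sub_le_excessRate hμ hΨ hN t t.2 hq ε le_rfl (hμε t)
  rw [sum_sub_distrib, sum_const, Fin.card_Iic, nsmul_eq_mul] at this
  rw [← excessRate_add_mul_busy_univ hμε]
  push_cast at this
  linarith

theorem prob_slow_busy_service_le (hμ : Antitone μ) (hπ : π ∈ stdSimplex ℝ (State N b))
    {K Ψ : ℝ → ℝ} {ε B δ p : ℝ} (hε : 0 ≤ ε) (hμε : ∀ n, ε ≤ μ n)
    (hΨ : ∀ y z, ε ≤ z → z ≤ y → (y - z) * K y ≤ Ψ y - Ψ z) (hN : 0 < N)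
    (hδ : Ψ (μ ⟨0, hN⟩) - Ψ ε ≤ δ) (hp : 0 ≤ p)
    (htail : ∀ i ≤ t, prob π {q | K (μ i) < deficit μ i q} ≤ p) :
    prob π {q | (t : ℕ) + 1 + B ≤ busy univ q ∧
      serviceRate μ (1 ≤ ·) q < ∑ n ∈ Iic t, μ n + ε * B - δ} ≤ N * p := by
  have hsub : {q : State N b | (t : ℕ) + 1 + B ≤ busy univ q ∧
      serviceRate μ (1 ≤ ·) q < ∑ n ∈ Iic t, μ n + ε * B - δ} ⊆
      ⋃ i ∈ Iic t, {q | K (μ i) < deficit μ i q} := by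
    rintro q ⟨hB, hslow⟩
    contrapose! hslow
    simp only [Set.mem_iUnion, Set.mem_ofPred_eq, mem_Iic, not_exists, not_lt] at hslow
    have hεB := mul_le_mul_of_nonneg_left (by linarith : B ≤ busy univ q - ((t : ℕ) + 1)) hε
    linarith [le_serviceRate_of_deficit_le hμ hμε hΨ hN hslow]
  calc _ ≤ ∑ i ∈ Iic t, prob π {q | K (μ i) < deficit μ i q} :=
        (prob_mono hπ hsub).trans (prob_biUnion_le hπ _ _)
    _ ≤ (Iic t).card • p := sum_le_card_nsmul _ _ _ fun i hi => htail i (mem_Iic.1 hi)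
    _ ≤ N * p := by
        rw [nsmul_eq_mul, Fin.card_Iic]
        exact mul_le_mul_of_nonneg_right (by exact_mod_cast t.2) hp

end Deficit

section Lyapunov

/-- The continuous piecewise linear function that increases from `0` at `c` to `1` at `c + w`. -/
noncomputable def ramp (c w y : ℝ) : ℝ := max 0 (min 1 ((y - c) / w))

/-- A discrete convex function whose slope increases from `0` to `1` between `c` and `c + w`. -/
noncomputable def rampSum (c w : ℝ) (n : ℕ) : ℝ := ∑ j ∈ range n, ramp c w j

theorem ramp_nonneg (c w y : ℝ) : 0 ≤ ramp c w y := le_max_left _ _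

theorem ramp_le_one (c w y : ℝ) : ramp c w y ≤ 1 := max_le zero_le_one (min_le_left _ _)

theorem ramp_eq_one {c w y : ℝ} (hw : 0 < w) (h : c + w ≤ y) : ramp c w y = 1 := by
  refine le_antisymm (ramp_le_one _ _ _) (le_max_of_le_right (le_min le_rfl ?_))
  rw [le_div_iff₀ hw]
  linarith

theorem ramp_eq_zero {c w y : ℝ} (hw : 0 < w) (h : y ≤ c) : ramp c w y = 0 :=
  max_eq_left (min_le_of_right_le (div_nonpos_of_nonpos_of_nonneg (sub_nonpos.2 h) hw.le))

theorem ramp_le_ramp_sub_one_add {c w : ℝ} (hw : 0 < w) (y : ℝ) :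
    ramp c w y ≤ ramp c w (y - 1) + 1 / w := by
  have hw' : 0 ≤ 1 / w := by positivity
  refine max_le (by linarith [ramp_nonneg c w (y - 1)]) ?_
  calc min 1 ((y - c) / w) = min 1 ((y - 1 - c) / w + 1 / w) := by ring_nf
    _ ≤ min 1 ((y - 1 - c) / w) + 1 / w := by
        rw [← min_add_add_right]
        exact min_le_min_right _ (by linarith)
    _ ≤ _ := add_le_add_left (le_max_right _ _) _

theorem rampSum_succ (c w : ℝ) (n : ℕ) : rampSum c w (n + 1) = rampSum c w n + ramp c w n :=
  sum_range_succ _ _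

theorem rampSum_nonneg (c w : ℝ) (n : ℕ) : 0 ≤ rampSum c w n :=
  sum_nonneg fun _ _ => ramp_nonneg _ _ _

theorem sub_le_rampSum {c w : ℝ} (hc : 0 ≤ c) (hw : 0 < w) (n : ℕ) :
    n - c - w - 1 ≤ rampSum c w n := by
  induction n with
  | zero => simp only [rampSum, range_zero, sum_empty, Nat.cast_zero]; linarith
  | succ n ih =>
    rw [rampSum_succ]
    push_cast
    rcases le_total (c + w) n with h | h
    · linarith [ramp_eq_one hw h]
    · linarith [rampSum_nonneg c w n, ramp_nonneg c w n]

theorem rampSum_le {c w : ℝ} (hw : 0 < w) (n : ℕ) : rampSum c w n ≤ max 0 (n - c) := by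
  induction n with
  | zero => simp [rampSum]
  | succ n ih =>
    rw [rampSum_succ]
    push_cast
    rcases le_total (n : ℝ) c with h | h
    · rw [ramp_eq_zero hw h, add_zero]
      exact ih.trans (max_le_max le_rfl (by linarith))
    · rw [max_eq_right (by linarith)] at ih
      exact le_max_of_le_right (by linarith [ramp_le_one c w n])

variable {N b : ℕ} {Λ : ℝ} {μ : Fin N → ℝ} {π : State N b → ℝ} {q : State N b} {c w : ℝ}

/-- The Lyapunov function of the sub-Halfin–Whitt regime: all waiting jobs count, but busy servers
only beyond about `c` of them, so that it decreases even while some of the fast servers idle. -/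
noncomputable def lyapunov (c w : ℝ) (q : State N b) : ℝ :=
  waiting q + rampSum c w (busy univ q).toNat

theorem cast_toNat_busy (q : State N b) : ((busy univ q).toNat : ℝ) = busy univ q := by
  exact_mod_cast Int.toNat_of_nonneg (busy_nonneg univ q)

theorem lyapunov_arrive_of_idle (hb : 0 < b) (c w : ℝ) {m : Fin N} (hm : (q m : ℕ) = 0) :
    lyapunov c w (arrive q m) = lyapunov c w q + ramp c w (busy univ q) := by
  have hbusy : (busy univ (arrive q m)).toNat = (busy univ q).toNat + 1 := by
    rw [busy_arrive hb, if_pos ⟨mem_univ _, hm⟩]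
    have := busy_nonneg univ q
    omega
  rw [lyapunov, lyapunov, hbusy, rampSum_succ, waiting_arrive hb, if_neg (by omega), add_zero,
    cast_toNat_busy, add_assoc]

theorem lyapunov_arrive_mem_Icc (hb : 0 < b) (hw : 0 < w) (hcw : c + w ≤ N) {m : Fin N}
    (hm : m ∈ fastestShortest μ q) : lyapunov c w (arrive q m) ∈
      Set.Icc (lyapunov c w q) (lyapunov c w q + ramp c w (busy univ q)) := by
  rcases (busy_univ_le q).lt_or_eq with hidle | hfull
  · obtain ⟨l, -, hl⟩ := exists_idle_of_busy_lt_card (G := univ) (by simpa using hidle)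
    rw [lyapunov_arrive_of_idle hb c w (idle_of_mem_fastestShortest hl hm).1]
    exact ⟨le_add_of_nonneg_right (ramp_nonneg _ _ _), le_rfl⟩
  · have hbusy : busy univ (arrive q m) = busy univ q := by
      have harrive := busy_arrive hb univ q m
      have := busy_univ_le (arrive q m)
      split_ifs at harrive <;> omega
    rw [lyapunov, lyapunov, hbusy, waiting_arrive hb, ramp_eq_one hw (by simpa [hfull] using hcw)]
    push_cast
    split_ifs <;> constructor <;> linarith

theorem lyapunov_depart (c w : ℝ) (q : State N b) (m : Fin N) :
    lyapunov c w (depart q m) = lyapunov c w q -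
      ((if (q m : ℕ) = 1 then ramp c w (busy univ q - 1) else 0) +
        if 2 ≤ (q m : ℕ) then 1 else 0) := by
  have hbusy := busy_depart univ q m
  have hnonneg := busy_nonneg univ (depart q m)
  simp only [mem_univ, true_and] at hbusy
  unfold lyapunov
  rw [waiting_depart]
  push_cast
  by_cases hm : (q m : ℕ) = 1
  · rw [if_pos hm] at hbusy
    have hsucc : (busy univ q).toNat = (busy univ (depart q m)).toNat + 1 := by omega
    rw [hsucc, rampSum_succ, cast_toNat_busy, hbusy, if_pos hm]
    push_cast
    ring
  · rw [if_neg hm, sub_zero] at hbusy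
    rw [hbusy, if_neg hm]
    ring

theorem abs_lyapunov_sub_le (hb : 0 < b) (hw : 0 < w) (hcw : c + w ≤ N) {q' : State N b}
    (h : rate Λ μ q q' ≠ 0) : |lyapunov c w q' - lyapunov c w q| ≤ 1 := by
  rw [abs_le]
  rcases exists_arrive_or_depart_of_rate_ne_zero h with ⟨n, hn, rfl⟩ | ⟨n, rfl⟩
  · obtain ⟨hlow, hup⟩ := lyapunov_arrive_mem_Icc hb hw hcw hn
    constructor <;> linarith [ramp_le_one c w (busy univ q)]
  · have hlow := ramp_nonneg c w (busy univ q - 1)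
    have hup := ramp_le_one c w (busy univ q - 1)
    rw [lyapunov_depart]
    split_ifs <;> first | omega | (constructor <;> linarith)

theorem sum_rate_mul_lyapunov_up_le (hN : 0 < N) (hb : 0 < b) (hΛ : 0 ≤ Λ) (hμ : ∀ n, 0 ≤ μ n)
    (hw : 0 < w) (hcw : c + w ≤ N) (q : State N b) :
    ∑ q', rate Λ μ q q' * max (lyapunov c w q' - lyapunov c w q) 0 ≤ Λ := by
  refine (sum_rate_mul_le hN hΛ hμ (a := 1) (d := fun _ => 0) (fun n hn => ?_)
    fun n => ?_).trans_eq (by simp)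
  · have := (lyapunov_arrive_mem_Icc hb hw hcw hn).2
    exact max_le (by linarith [ramp_le_one c w (busy univ q)]) zero_le_one
  · rw [lyapunov_depart]
    refine max_le ?_ le_rfl
    split_ifs <;> linarith [ramp_nonneg c w (busy univ q - 1)]

theorem gen_lyapunov_le (hN : 0 < N) (hb : 0 < b) (hΛ : 0 ≤ Λ) (hμ : ∀ n, 0 ≤ μ n)
    (hw : 0 < w) (hcw : c + w ≤ N) (q : State N b) :
    gen (rate Λ μ) (lyapunov c w) q ≤ Λ / w
      - ramp c w (busy univ q - 1) * (serviceRate μ (1 ≤ ·) q - Λ)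
      - (1 - ramp c w (busy univ q - 1)) * serviceRate μ (2 ≤ ·) q := by
  set s := ramp c w (busy univ q - 1)
  calc gen (rate Λ μ) (lyapunov c w) q
      ≤ Λ * ramp c w (busy univ q) + ∑ n, μ n *
        ((if (q n : ℕ) = 1 then -s else 0) + if 2 ≤ (q n : ℕ) then -1 else 0) := by
        refine sum_rate_mul_le hN hΛ hμ
          (fun n hn => sub_le_iff_le_add'.2 (lyapunov_arrive_mem_Icc hb hw hcw hn).2) fun n => ?_
        rw [lyapunov_depart]
        split_ifs <;> linarith
    _ = Λ * ramp c w (busy univ q) - s * serviceRate μ (· = 1) q - serviceRate μ (2 ≤ ·) q := by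
        simp only [mul_add, sum_add_distrib]
        rw [sum_mul_ite_eq_mul_serviceRate μ (· = 1), sum_mul_ite_eq_mul_serviceRate μ (2 ≤ ·)]
        ring
    _ ≤ Λ * (s + 1 / w) - s * serviceRate μ (· = 1) q - serviceRate μ (2 ≤ ·) q := by
        gcongr
        exact ramp_le_ramp_sub_one_add hw _
    _ = _ := by rw [← serviceRate_one_add_serviceRate_ge_two]; ring

theorem two_mul_le_serviceRate_ge_two {ε γ : ℝ} (hb : 2 ≤ b) (hε : 0 ≤ ε) (hμ : ∀ n, ε ≤ μ n)
    (hw : 0 < w) (hγw : 2 * γ * (b - 1) ≤ ε * w) (hq : 2 * (w + 1) < lyapunov c w q)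
    (hB : busy univ q - 1 ≤ c + w) : 2 * γ ≤ serviceRate μ (2 ≤ ·) q := by
  have hb1 : (0 : ℝ) < (b : ℝ) - 1 := sub_pos.2 (by exact_mod_cast hb)
  have few_counted : rampSum c w (busy univ q).toNat ≤ w + 1 := by
    refine (rampSum_le hw _).trans (max_le (by linarith) ?_)
    linarith [cast_toNat_busy q]
  have many_waiting : w ≤ waiting q := by
    unfold lyapunov at hq
    linarith
  refine le_of_mul_le_mul_left ?_ hb1
  calc _ ≤ ε * w := by linarith
    _ ≤ ε * waiting q := by gcongr
    _ ≤ _ := mul_waiting_le hε hμ q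

theorem prob_lyapunov_ge_le (hN : 0 < N) (hb : 2 ≤ b) (hΛ : 0 ≤ Λ) (hΛN : Λ ≤ N)
    (hπ : IsSteadyState Λ μ π) {ε γ : ℝ} (hε : 0 < ε) (hμ : ∀ n, ε ≤ μ n)
    (hw : 0 < w) (hcw : c + w ≤ N) (hγ : 0 < γ) (hγw : 2 * γ * (b - 1) ≤ ε * w)
    (hwγ : Λ / w ≤ γ) (n : ℕ) :
    prob π {q | 2 * (w + 1) + 2 * n ≤ lyapunov c w q} ≤ Real.exp (-(n * (γ / (N + γ)))) +
      prob π {q | c + 1 ≤ busy univ q ∧ serviceRate μ (1 ≤ ·) q < Λ + 2 * γ} *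
        ((N + γ) / γ) := by
  have hb0 : 0 < b := by omega
  have hμ0 : ∀ n, 0 ≤ μ n := fun n => hε.le.trans (hμ n)
  refine prob_le_exp_of_drift (rate_nonneg hΛ hμ0) hπ.isInvariant N.cast_nonneg hγ
    (fun q q' => abs_lyapunov_sub_le hb0 hw hcw)
    (fun q _ => (sum_rate_mul_lyapunov_up_le hN hb0 hΛ hμ0 hw hcw q).trans hΛN)
    (fun q hq hgood => (gen_lyapunov_le hN hb0 hΛ hμ0 hw hcw q).trans ?_) n
  simp only [Set.mem_ofPred_eq, not_and, not_lt] at hgood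
  have hs0 := ramp_nonneg c w (busy univ q - 1)
  have hs1 := ramp_le_one c w (busy univ q - 1)
  have one_le : ramp c w (busy univ q - 1) * (2 * γ) ≤
      ramp c w (busy univ q - 1) * (serviceRate μ (1 ≤ ·) q - Λ) := by
    rcases le_total (c + 1) (busy univ q) with hB | hB
    · gcongr
      linarith [hgood hB]
    · simp [ramp_eq_zero hw (by linarith : (busy univ q : ℝ) - 1 ≤ c)]
  have two_le : (1 - ramp c w (busy univ q - 1)) * (2 * γ) ≤
      (1 - ramp c w (busy univ q - 1)) * serviceRate μ (2 ≤ ·) q := by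
    rcases le_total (c + w) (busy univ q - 1) with hB | hB
    · simp [ramp_eq_one hw hB]
    · exact mul_le_mul_of_nonneg_left (two_mul_le_serviceRate_ge_two hb hε.le hμ hw hγw hq hB)
        (by linarith)
  linarith

end Lyapunov

section SubRegime

variable {N b : ℕ} {μ : Fin N → ℝ} {π : State N b → ℝ} {t : Fin N} {M κ κ₁ R ℓ ε x : ℝ}

/-- The deficit tolerated among the servers with rate at least `y`: of the order of the diffusive
fluctuations for rates up to `M`, and a constant for higher rates. -/
noncomputable def tolerance (M κ κ₁ y : ℝ) : ℝ := if y ≤ M then κ / √y else κ₁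

/-- An antiderivative of a bound for `tolerance`. Its increase over the range of the rates bounds
the total service rate lost to tolerated deficits. -/
noncomputable def toleratedLoss (M κ κ₁ y : ℝ) : ℝ := κ₁ * y + 2 * κ * √(min y M)

theorem sub_mul_div_sqrt_le (hκ : 0 ≤ κ) {y z : ℝ} (hz : 0 ≤ z) (hzy : z ≤ y) :
    (y - z) * (κ / √y) ≤ 2 * κ * (√y - √z) := by
  have hsqrt : √z ≤ √y := Real.sqrt_le_sqrt hzy
  calc (y - z) * (κ / √y) = κ * (y / √y - z / √y) := by ring
    _ ≤ κ * (√y - (2 * √z - √y)) := by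
        rw [Real.div_sqrt]
        gcongr
        rcases (Real.sqrt_nonneg y).eq_or_lt with h | h
        · simp [← h, le_antisymm (h ▸ hsqrt) (Real.sqrt_nonneg z)]
        · rw [le_div_iff₀ h]
          nlinarith [Real.mul_self_sqrt hz, sq_nonneg (√y - √z)]
    _ = _ := by ring

theorem sub_mul_tolerance_le (hκ : 0 ≤ κ) (hκ₁ : 0 ≤ κ₁) {y z : ℝ} (hz : 0 ≤ z) (hzy : z ≤ y) :
    (y - z) * tolerance M κ κ₁ y ≤ toleratedLoss M κ κ₁ y - toleratedLoss M κ κ₁ z := by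
  unfold tolerance toleratedLoss
  split_ifs with h
  · rw [min_eq_left h, min_eq_left (hzy.trans h)]
    linarith [sub_mul_div_sqrt_le hκ hz hzy, mul_nonneg hκ₁ (sub_nonneg.2 hzy)]
  · have hsqrt : √(min z M) ≤ √(min y M) := Real.sqrt_le_sqrt (min_le_min_right _ hzy)
    linarith [mul_le_mul_of_nonneg_left hsqrt (by positivity : 0 ≤ 2 * κ)]

theorem two_mul_mul_sqrt_le {n c : ℝ} (hn : 0 ≤ n) (hε : 0 ≤ ε) (hx : 0 ≤ x)
    (hc : 0 ≤ c) (hκ2 : κ ^ 2 = 8 * n * R * ℓ) (hℓ : 0 ≤ ℓ) (hεℓ : 2 * R ≤ ε * ℓ)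
    (hcap : ε * n ≤ 2 * x) (hcx : 256 * ℓ ^ 2 * c ≤ ε ^ 2 * x) :
    2 * κ * √c ≤ 3 / 8 * (ε * x) := by
  refine abs_le_of_sq_le_sq' ?_ (by positivity) |>.2
  have hRc : 2 * (R * ℓ * c) ≤ ε * (ε ^ 2 * x / 256) := by
    calc 2 * (R * ℓ * c) = 2 * R * (ℓ * c) := by ring
      _ ≤ ε * ℓ * (ℓ * c) := by gcongr
      _ = ε * (ℓ ^ 2 * c) := by ring
      _ ≤ _ := by gcongr; linarith
  calc (2 * κ * √c) ^ 2 = 4 * κ ^ 2 * √c ^ 2 := by ring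
    _ = 16 * n * (2 * (R * ℓ * c)) := by rw [hκ2, Real.sq_sqrt hc]; ring
    _ ≤ 16 * n * (ε * (ε ^ 2 * x / 256)) := by gcongr
    _ = ε * n * (ε ^ 2 * x / 16) := by ring
    _ ≤ 2 * x * (ε ^ 2 * x / 16) := by gcongr
    _ ≤ _ := by nlinarith [sq_nonneg (ε * x)]

theorem four_mul_le {g n : ℝ} (hε : 0 < ε) (hε1 : ε ≤ 1) (hRℓ : 16 ≤ R * ℓ) (hg : 0 ≤ g)
    (hx : 0 ≤ x) (hgn : g ^ 2 = n) (hκ2 : κ ^ 2 = 8 * n * R * ℓ)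
    (hgx : 2916 * R ^ 2 * ℓ ^ 2 * g ≤ ε ^ 2 * x) : 4 * κ ≤ ε * x / 4 := by
  have hκ : κ ≤ R * ℓ * g := by
    refine abs_le_of_sq_le_sq' ?_ (by positivity) |>.2
    rw [hκ2, ← hgn]
    nlinarith [mul_nonneg (sq_nonneg g) (by linarith : 0 ≤ R * ℓ)]
  have hεx : ε ^ 2 * x ≤ ε * x := by
    gcongr
    nlinarith
  nlinarith [mul_nonneg hg (by linarith : 0 ≤ R * ℓ)]

theorem prob_slow_busy_service_le_of_tolerance (hN : 0 < N) (hb : 0 < b) (hμ : Antitone μ)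
    (hε : 0 < ε) (hμε : ∀ n, ε ≤ μ n) (hsum : ∑ n, μ n = N) (hΛ : 0 ≤ (N : ℝ) - x)
    (hπ : IsSteadyState ((N : ℝ) - x) μ π) (ht : ∑ n ∈ Iic t, μ n = N - x) (hR : 2 ≤ R)
    (hℓ : 1 ≤ ℓ) (hκ : 0 < κ) (hκ2 : κ ^ 2 = 8 * N * R * ℓ) (hκ₁ : 0 ≤ κ₁)
    (hμN : 3200 * (R * ℓ) * μ ⟨0, hN⟩ ≤ N)
    (hloss : toleratedLoss M κ κ₁ (μ ⟨0, hN⟩) ≤ 3 / 8 * (ε * x))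
    (hfast : ∀ i, M < μ i →
      prob π {q | κ₁ < deficit μ i q} ≤ Real.exp (-((R + 1 / 2) * ℓ))) :
    prob π {q | (t : ℕ) + 1 + x / 2 ≤ busy univ q ∧
      serviceRate μ (1 ≤ ·) q < N - x + ε * x / 8} ≤ N * Real.exp (-((R + 1 / 2) * ℓ)) := by
  have hloss_nonneg : 0 ≤ toleratedLoss M κ κ₁ ε := by unfold toleratedLoss; positivity
  have hrate : N - x + ε * x / 8 = ∑ n ∈ Iic t, μ n + ε * (x / 2) - 3 / 8 * (ε * x) := by
    rw [ht]; ring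
  rw [hrate]
  refine prob_slow_busy_service_le (B := x / 2) (δ := 3 / 8 * (ε * x)) (K := tolerance M κ κ₁)
    (Ψ := toleratedLoss M κ κ₁) hμ hπ.1 hε.le hμε
    (fun y z hz hzy => sub_mul_tolerance_le hκ.le hκ₁ (hε.le.trans hz) hzy) hN (by linarith)
    (Real.exp_pos _).le fun i hi => ?_
  unfold tolerance
  split_ifs with hM
  · refine prob_deficit_gt_sqrt_le hN hb (fun n => hε.trans_le (hμε n)) hμ hsum hΛ hπ
      (ht ▸ ?_) hR hℓ hκ hκ2 (hμN.trans' ?_)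
    · exact sum_le_sum_of_subset_of_nonneg (Iic_subset_Iic.2 hi)
        fun n _ _ => hε.le.trans (hμε n)
    · exact mul_le_mul_of_nonneg_left (hμ (by simp [Fin.le_def])) (by positivity)
  · exact hfast i (not_le.1 hM)

theorem prob_slow_busy_service_le_exp (hN : 0 < N) (hb : 0 < b) (hμ : Antitone μ) (hε : 0 < ε)
    (hμε : ∀ n, ε ≤ μ n) (hε2 : ε ≤ 1 / 2) (hsum : ∑ n, μ n = N) (hΛ : 0 ≤ (N : ℝ) - x)
    (hπ : IsSteadyState ((N : ℝ) - x) μ π) (ht : ∑ n ∈ Iic t, μ n = N - x) (hR : 2 ≤ R)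
    (hεℓ : 2 * R ≤ ε * ℓ) (hx0 : 0 < x)
    (hx : 2916 * R ^ 2 * ℓ ^ 2 * √N ≤ ε ^ 2 * x)
    (hμx : 256 * ℓ ^ 2 * μ ⟨0, hN⟩ ≤ ε ^ 2 * x) :
    prob π {q | (t : ℕ) + 1 + x / 2 ≤ busy univ q ∧
      serviceRate μ (1 ≤ ·) q < N - x + ε * x / 8} ≤ N * Real.exp (-((R + 1 / 2) * ℓ)) := by
  have hN0 : (0 : ℝ) < N := Nat.cast_pos.2 hN
  have hμ₁ : 0 < μ ⟨0, hN⟩ := hε.trans_le (hμε _)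
  have hℓ : 4 * R ≤ ℓ := by nlinarith
  have hℓ8 : 8 ≤ ℓ := by linarith
  have hRμ : R * ℓ * μ ⟨0, hN⟩ ≤ ε ^ 2 * x / 1024 := by
    nlinarith [mul_le_mul_of_nonneg_right hℓ (by positivity : 0 ≤ ℓ * μ ⟨0, hN⟩)]
  have hεx : ε ^ 2 * x ≤ 1 / 4 * x := by gcongr; nlinarith
  have hμN : 3200 * (R * ℓ) * μ ⟨0, hN⟩ ≤ N := by linarith
  have hκ : 0 < √(8 * N * R * ℓ) := Real.sqrt_pos.2 (by positivity)
  have hκ2 : √(8 * N * R * ℓ) ^ 2 = 8 * N * R * ℓ := Real.sq_sqrt (by positivity)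
  rcases le_total (2 * x) (ε * N) with hcap | hcap
  · refine prob_slow_busy_service_le_of_tolerance (M := 4) (κ₁ := 7 * R * ℓ / ε) hN hb hμ hε hμε
      hsum hΛ hπ ht hR (by linarith) hκ hκ2 (by positivity) hμN ?_ fun i hi =>
        prob_deficit_gt_le_of_four_le hN hb hμ hε hμε hε2 hsum hΛ hπ (by linarith) hR
          (by linarith) hi.le
    have hconst : 7 * R * ℓ / ε * μ ⟨0, hN⟩ ≤ ε * x / 8 := by
      rw [div_mul_eq_mul_div, div_le_iff₀ hε]
      nlinarith
    have hsqrt : √(min (μ ⟨0, hN⟩) 4) ≤ 2 :=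
      Real.sqrt_le_iff.2 ⟨zero_le_two, (min_le_right _ _).trans (by norm_num)⟩
    have := four_mul_le hε (by linarith) (by nlinarith) (Real.sqrt_nonneg N) hx0.le
      (Real.sq_sqrt hN0.le) hκ2 hx
    unfold toleratedLoss
    nlinarith
  · refine prob_slow_busy_service_le_of_tolerance (M := μ ⟨0, hN⟩) (κ₁ := 0) hN hb hμ hε hμε
      hsum hΛ hπ ht hR (by linarith) hκ hκ2 le_rfl hμN ?_ fun i hi =>
        absurd (hμ (by simp [Fin.le_def])) hi.not_ge
    rw [toleratedLoss, min_self, zero_mul, zero_add]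
    exact two_mul_mul_sqrt_le hN0.le hε.le hx0.le hμ₁.le hκ2 (by linarith) hεℓ hcap
      hμx

theorem mul_le_of_sq_mul_le {a : ℝ} (hε : 0 < ε) (hε2 : ε ≤ 1 / 2) (hRℓ : 16 ≤ R * ℓ)
    (ha : 0 ≤ a) (hx : 729 * (R * ℓ) ^ 2 * a ≤ ε ^ 2 * x) : 23328 * (R * ℓ * a) ≤ ε * x := by
  have hεx : ε * (ε * x) ≤ 1 / 2 * (ε * x) := by
    have : 0 ≤ ε ^ 2 * x := hx.trans' (by positivity)
    have : 0 ≤ ε * x := by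
      refine nonneg_of_mul_nonneg_right (?_ : 0 ≤ ε * (ε * x)) hε
      linarith
    gcongr
  have := mul_le_mul_of_nonneg_right hRℓ (by positivity : 0 ≤ R * ℓ * a)
  linarith

theorem drift_rate_bounds {g n y : ℝ} (hε : 0 < ε) (hε2 : ε ≤ 1 / 2) (hRℓ : 16 ≤ R * ℓ)
    (hg : 0 ≤ g) (hgn : g ^ 2 = n) (hy : 1 ≤ y)
    (hx : 729 * R ^ 2 * y ^ 2 * ℓ ^ 2 * g ≤ ε ^ 2 * x) (hx0 : 0 ≤ x) :
    2 * g ≤ ε * x / (64 * y) ∧ 64 * (n * (R * ℓ)) ≤ ε * x / (64 * y) * x := by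
  have hεx : 23328 * (R * ℓ * (y ^ 2 * g)) ≤ ε * x :=
    mul_le_of_sq_mul_le hε hε2 hRℓ (by positivity) (hx.trans_eq' (by ring))
  rw [div_mul_eq_mul_div, le_div_iff₀ (by positivity), le_div_iff₀ (by positivity)]
  refine ⟨hεx.trans' ?_, ?_⟩
  · have hone : 1 ≤ R * ℓ * y := one_le_mul_of_one_le_of_one_le (by linarith) hy
    calc 2 * g * (64 * y) = 128 * (y * g) * 1 := by ring
      _ ≤ 128 * (y * g) * (R * ℓ * y) := by gcongr
      _ ≤ _ := by linarith [show 0 ≤ R * ℓ * (y ^ 2 * g) by positivity]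
  · have hn : 0 ≤ n := hgn ▸ sq_nonneg g
    have hone : 1 ≤ R * ℓ * y ^ 3 :=
      one_le_mul_of_one_le_of_one_le (by linarith) (one_le_pow₀ hy)
    calc 64 * (n * (R * ℓ)) * (64 * y) = 4096 * (n * y * (R * ℓ)) * 1 := by ring
      _ ≤ 4096 * (n * y * (R * ℓ)) * (R * ℓ * y ^ 3) := by gcongr
      _ = 4096 * (R * ℓ * (y ^ 2 * g)) ^ 2 := by rw [← hgn]; ring
      _ ≤ (23328 * (R * ℓ * (y ^ 2 * g))) ^ 2 := by
          linarith [sq_nonneg (R * ℓ * (y ^ 2 * g))]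
      _ ≤ (ε * x) ^ 2 := by gcongr
      _ = ε * (ε * x * x) := by ring
      _ ≤ 1 * (ε * x * x) := by
          gcongr
          linarith
      _ = ε * x * x := one_mul _

theorem mul_exp_mul_div_le (hN : 0 < N) (r : ℕ) {γ : ℝ} (hγ : 2 * √N ≤ γ) (hγN : γ ≤ N) :
    N * Real.exp (-((r + 1 + 1 / 2) * Real.log N)) * ((N + γ) / γ) ≤ 1 / N ^ r := by
  have hN0 : (0 : ℝ) < N := Nat.cast_pos.2 hN
  have hsqrt : 0 < √(N : ℝ) := Real.sqrt_pos.2 hN0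
  have hexp : Real.exp (-((r + 1 + 1 / 2) * Real.log N)) = 1 / N ^ r * (N * √N)⁻¹ := by
    rw [← exp_neg_natCast_mul_log hN0, ← Real.exp_log (mul_pos hN0 hsqrt), ← Real.exp_neg,
      ← Real.exp_add, Real.log_mul hN0.ne' hsqrt.ne', Real.log_sqrt hN0.le]
    ring_nf
  have hratio : (N + γ) / γ ≤ √N := by
    rw [div_le_iff₀ (by linarith)]
    nlinarith [Real.mul_self_sqrt hN0.le]
  calc _ ≤ N * (1 / N ^ r * (N * √N)⁻¹) * √N := by rw [hexp]; gcongr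
    _ = _ := by field_simp

theorem setOf_total_gt_subset {n : ℝ} (hx : 96 ≤ x) (hn : n ≤ x / 16) :
    {q : State N b | (t : ℕ) + 1 + 3 / 4 * x < total q} ⊆
      {q | 2 * (x / 32 + 1) + 2 * n ≤ lyapunov ((t : ℕ) + 1 + x / 2) (x / 32) q} := by
  intro q hq
  have hbusy := sub_le_rampSum (c := (t : ℕ) + 1 + x / 2) (w := x / 32) (by positivity)
    (by linarith) (busy univ q).toNat
  rw [Set.mem_ofPred_eq, total_eq_busy_add_waiting, Int.cast_add] at hq
  rw [Set.mem_ofPred_eq, lyapunov]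
  linarith [cast_toNat_busy q]

theorem prob_total_gt_le_add (hN : 0 < N) (hb : 2 ≤ b) (hμ : Antitone μ) (hε : 0 < ε)
    (hμε : ∀ n, ε ≤ μ n) (hsum : ∑ n, μ n = N) (hΛ : 0 ≤ (N : ℝ) - x)
    (hπ : IsSteadyState ((N : ℝ) - x) μ π) (ht : ∑ n ∈ Iic t, μ n = N - x) (hx : 96 ≤ x)
    {γ : ℝ} (hγ : 0 < γ) (hγN : γ ≤ N) (hγx : γ * (64 * b) ≤ ε * x)
    (hwγ : 32 * ((N : ℝ) - x) ≤ γ * x) :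
    prob π {q | (t : ℕ) + 1 + 3 / 4 * x < total q} ≤ Real.exp (-(x / 32 * (γ / (2 * N)))) +
      prob π {q | (t : ℕ) + 1 + x / 2 ≤ busy univ q ∧
        serviceRate μ (1 ≤ ·) q < N - x + ε * x / 8} * ((N + γ) / γ) := by
  have hbR : (2 : ℝ) ≤ b := by exact_mod_cast hb
  have htN : ((t : ℕ) : ℝ) + 1 ≤ N - x := by
    linarith [sum_Ioi_le hμ hsum t, sum_Iic_add_sum_Ioi μ t]
  have hfloor : x / 32 ≤ ⌊x / 16⌋₊ := by linarith [Nat.lt_floor_add_one (x / 16)]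
  have hγ2 : 2 * γ ≤ ε * x / 8 := by nlinarith
  refine (prob_mono hπ.1 (setOf_total_gt_subset hx (Nat.floor_le (by positivity)))).trans
    ((prob_lyapunov_ge_le hN hb hΛ (by linarith) hπ hε hμε (by linarith) (by linarith) hγ
      (by linarith) ?_ _).trans ?_)
  · rw [div_le_iff₀ (by linarith)]
    linarith
  · gcongr
    · linarith
    · refine prob_mono hπ.1 fun q hq => ⟨?_, hq.2.trans_le (by linarith)⟩
      linarith [hq.1]

theorem prob_total_gt_le (hN : 0 < N) (hb : 2 ≤ b) (hμ : Antitone μ) (hε : 0 < ε)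
    (hμε : ∀ n, ε ≤ μ n) (hε2 : ε ≤ 1 / 2) (hsum : ∑ n, μ n = N) {r : ℕ} (hr : 0 < r)
    (hx0 : 0 < x) (hΛ : 0 ≤ (N : ℝ) - x) (hπ : IsSteadyState ((N : ℝ) - x) μ π)
    (ht : ∑ n ∈ Iic t, μ n = N - x) (hεℓ : 2 * ((r : ℝ) + 1) ≤ ε * Real.log N)
    (hx : 729 * ((r : ℝ) + 1) ^ 2 * b ^ 2 * Real.log N ^ 2 * √N ≤ ε ^ 2 * x)
    (hμ₁ : 256 * Real.log N ^ 2 * μ ⟨0, hN⟩ ≤ ε ^ 2 * x) :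
    prob π {q | (t : ℕ) + 1 + 3 / 4 * x < total q} ≤ 2 * (1 / N ^ r) := by
  have hN0 : (0 : ℝ) < N := Nat.cast_pos.2 hN
  have hrR : (1 : ℝ) ≤ r := by exact_mod_cast hr
  have hbR : (2 : ℝ) ≤ b := by exact_mod_cast hb
  have hsqrt : 1 ≤ √(N : ℝ) := Real.one_le_sqrt.2 (by exact_mod_cast hN)
  have hℓ : 8 ≤ Real.log N := by nlinarith
  obtain ⟨hγ, hγx⟩ := drift_rate_bounds hε hε2 (by nlinarith) (Real.sqrt_nonneg N)
    (Real.sq_sqrt hN0.le) (by linarith) hx hx0.le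
  have hγb : ε * x / (64 * b) * (64 * b) = ε * x := div_mul_cancel₀ _ (by positivity)
  set γ := ε * x / (64 * b)
  have hγ128 : 128 * γ ≤ ε * x := by nlinarith
  have hεx : ε * x ≤ 1 / 2 * x := by gcongr
  have hγN : γ ≤ N := by linarith
  have hrℓ : N * (r * Real.log N) ≤ N * ((r + 1) * Real.log N) := by gcongr; linarith
  refine (prob_total_gt_le_add hN hb hμ hε hμε hsum hΛ hπ ht (by linarith) (by linarith) hγN
    hγb.le ?_).trans ?_
  · have := mul_le_mul_of_nonneg_left (by nlinarith : 1 ≤ (r + 1) * Real.log N) hN0.le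
    linarith
  rw [two_mul (1 / (N : ℝ) ^ r)]
  have hfluct : 2916 * ((r : ℝ) + 1) ^ 2 * Real.log N ^ 2 * √N ≤ ε ^ 2 * x := by
    calc _ = 729 * ((r : ℝ) + 1) ^ 2 * 2 ^ 2 * Real.log N ^ 2 * √N := by ring
      _ ≤ 729 * ((r : ℝ) + 1) ^ 2 * b ^ 2 * Real.log N ^ 2 * √N := by gcongr
      _ ≤ _ := hx
  have hslow := prob_slow_busy_service_le_exp hN (by omega) hμ hε hμε hε2 hsum hΛ hπ ht
    (by linarith) hεℓ hx0 hfluct hμ₁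
  have : 0 ≤ γ := by linarith
  refine add_le_add ?_ ((mul_le_mul_of_nonneg_right hslow (by positivity)).trans
    (mul_exp_mul_div_le hN r hγ hγN))
  rw [← exp_neg_natCast_mul_log hN0, Real.exp_le_exp, neg_le_neg_iff, ← mul_div_assoc,
    le_div_iff₀ (by positivity)]
  linarith

theorem avgQueue_le (hN : 0 < N) (q : State N b) : avgQueue q ≤ b := by
  rw [avgQueue_eq_total_div, div_le_iff₀ (Nat.cast_pos.2 hN)]
  exact_mod_cast total_le q

theorem expect_le_of_prob_total_gt_le (hN : 0 < N) (hπ : π ∈ stdSimplex ℝ (State N b)) {r : ℕ}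
    (hr : r ≠ 0) {k δ p : ℝ} (hx : 0 < x) (hxN : x ≤ N) (hk : 2 * b ≤ k) (hδ : δ ≤ 1 / 4)
    (hp : prob π {q | p + 3 / 4 * x < total q} ≤ 2 * (1 / N ^ r)) (hp0 : 0 ≤ p) :
    expect π (fun q => max (avgQueue q - p / N - (1 - δ) * (x / N)) 0 ^ r) ≤ (k / x) ^ r := by
  have hbk : (2 * b / N : ℝ) ≤ k / x := div_le_div₀ (hk.trans' (by positivity)) hk hx hxN
  calc _ ≤ (b : ℝ) ^ r * prob π {q | p + 3 / 4 * x < total q} := by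
        refine sum_mul_le_mul_prob hπ (fun q _ => ?_) fun q hq => ?_
        · refine pow_le_pow_left₀ (le_max_right _ _) (max_le ?_ b.cast_nonneg) r
          have : 0 ≤ (1 - δ) * (x / N) := mul_nonneg (by linarith) (by positivity)
          have : 0 ≤ p / N := by positivity
          linarith [avgQueue_le hN q]
        · have hq : (total q : ℝ) / N ≤ (p + 3 / 4 * x) / N := by gcongr; exact not_lt.1 hq
          have : 3 / 4 * (x / N) ≤ (1 - δ) * (x / N) := by gcongr; linarith
          rw [max_eq_right, zero_pow hr]
          rw [avgQueue_eq_total_div]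
          rw [add_div, mul_div_assoc] at hq
          linarith
    _ ≤ (b : ℝ) ^ r * (2 ^ r * (1 / N ^ r)) := by
        refine mul_le_mul_of_nonneg_left (hp.trans ?_) (by positivity)
        gcongr
        exact le_self_pow₀ one_le_two hr
    _ = (2 * b / N) ^ r := by rw [div_pow, mul_pow]; ring
    _ ≤ _ := by gcongr

theorem kSub_bounds (hb : 2 ≤ b) (hε : 0 < ε) (hε2 : ε ≤ 1 / 2) {y : ℝ} (hy : ε ≤ y) :
    2 * b ≤ kSub b ε y ∧ 4 / (kSub b ε y * ε) ≤ 1 / 4 := by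
  have hbR : (2 : ℝ) ≤ b := by exact_mod_cast hb
  have hkε : 16 * ((b : ℝ) - 1) ≤ kSub b ε y * ε := by
    rw [kSub, div_mul_eq_mul_div, le_div_iff₀ (by positivity)]
    calc 16 * ((b : ℝ) - 1) * ε ^ 2 = 16 * (b - 1) * ε * ε := by ring
      _ ≤ 16 * (b - 1) * y * ε := by
          gcongr
          linarith
  have hk : 0 < kSub b ε y := pos_of_mul_pos_left (by linarith) hε.le
  constructor
  · nlinarith
  · rw [div_le_div_iff₀ (by positivity) (by norm_num)]
    linarith

theorem expect_le_of_large_capacity (hN : 0 < N) (hb : 2 ≤ b) (hμ : Antitone μ) (hε : 0 < ε)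
    (hμε : ∀ n, ε ≤ μ n) (hε2 : ε ≤ 1 / 2) (hsum : ∑ n, μ n = N) {r : ℕ} (hr : 0 < r)
    (hx0 : 0 < x) (hΛ : 0 ≤ (N : ℝ) - x) (hπ : IsSteadyState ((N : ℝ) - x) μ π)
    (ht : ∑ n ∈ Iic t, μ n = N - x) (hεℓ : 2 * ((r : ℝ) + 1) ≤ ε * Real.log N)
    (hx : 729 * ((r : ℝ) + 1) ^ 2 * b ^ 2 * Real.log N ^ 2 * √N ≤ ε ^ 2 * x)
    (hμ₁ : 256 * Real.log N ^ 2 * μ ⟨0, hN⟩ ≤ ε ^ 2 * x) :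
    expect π (fun q => max (avgQueue q - ((t : ℕ) + 1) / N
      - (1 - 4 / (kSub b ε (μ t) * ε)) * (x / N)) 0 ^ r) ≤ (kSub b ε (μ t) / x) ^ r :=
  expect_le_of_prob_total_gt_le hN hπ.1 hr.ne' hx0 (sub_nonneg.1 hΛ)
    (kSub_bounds hb hε hε2 (hμε t)).1 (kSub_bounds hb hε hε2 (hμε t)).2
    (prob_total_gt_le hN hb hμ hε hμε hε2 hsum hr hx0 hΛ hπ ht hεℓ hx hμ₁) (by positivity)

end SubRegime

section Parameters

variable {N b r : ℕ} {α ε μ₁ : ℝ}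

theorem load_mul (hN : 0 < N) (α : ℝ) : load N α * N = N - (N : ℝ) ^ (1 - α) := by
  rw [load, sub_mul, one_mul, sub_eq_add_neg 1 α, add_comm 1, Real.rpow_add (Nat.cast_pos.2 hN),
    Real.rpow_one]

theorem rpow_one_sub_div (hN : 0 < N) (α : ℝ) : (N : ℝ) ^ (1 - α) / N = 1 / (N : ℝ) ^ α := by
  have hN0 : (0 : ℝ) < N := Nat.cast_pos.2 hN
  rw [Real.rpow_sub hN0, Real.rpow_one, div_right_comm, div_self hN0.ne']

theorem sq_rpow_one_sub_le (hN : 0 < N) (hα : 1 / 2 ≤ α) : ((N : ℝ) ^ (1 - α)) ^ 2 ≤ N := by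
  rw [← Real.rpow_natCast, ← Real.rpow_mul N.cast_nonneg]
  exact Real.rpow_le_self_of_one_le (by exact_mod_cast hN) (by push_cast; linarith)

theorem sqrt_mul_sq_rpow (hN : 0 < N) (α : ℝ) :
    √(N : ℝ) * ((N : ℝ) ^ (0.25 - 0.5 * α)) ^ 2 = (N : ℝ) ^ (1 - α) := by
  rw [Real.sqrt_eq_rpow, ← Real.rpow_natCast, ← Real.rpow_mul N.cast_nonneg,
    ← Real.rpow_add (Nat.cast_pos.2 hN)]
  norm_num
  ring_nf

theorem filter_val_lt_eq_Iic {N₂ : ℕ} (h : N₂ - 1 < N) (hN₂ : 1 ≤ N₂) :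
    univ.filter (fun n : Fin N => (n : ℕ) < N₂) = Iic ⟨N₂ - 1, h⟩ := by
  ext n
  simp only [mem_filter, mem_univ, true_and, mem_Iic, Fin.le_def]
  omega

theorem SubCondition.two_mul_le (hN : 2 ≤ N) (h : SubCondition N b r α ε μ₁) :
    2 * ((r : ℝ) + 1) ≤ ε * Real.log N :=
  (div_le_iff₀ (Real.log_pos (by exact_mod_cast hN))).1 ((le_max_left _ _).trans h.1)

theorem SubCondition.le_half (h : SubCondition N b r α ε μ₁) : ε ≤ 1 / 2 :=
  h.2.1.trans (by norm_num)

theorem SubCondition.sqrt_le (hN : 0 < N) (h : SubCondition N b r α ε μ₁) :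
    729 * ((r : ℝ) + 1) ^ 2 * b ^ 2 * Real.log N ^ 2 * √N ≤ ε ^ 2 * (N : ℝ) ^ (1 - α) := by
  have hbound := (div_le_iff₀ (by positivity)).1 ((le_max_right _ _).trans h.1)
  calc _ = √N * (27 * (r + 1) * b * Real.log N) ^ 2 := by ring
    _ ≤ √N * (ε * (N : ℝ) ^ (0.25 - 0.5 * α)) ^ 2 := by gcongr
    _ = ε ^ 2 * (√N * ((N : ℝ) ^ (0.25 - 0.5 * α)) ^ 2) := by ring
    _ = _ := by rw [sqrt_mul_sq_rpow hN]

theorem SubCondition.rate_le (hb : 2 ≤ b) (hε : 0 < ε) (hμ₁ : 0 ≤ μ₁)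
    (h : SubCondition N b r α ε μ₁) :
    256 * Real.log N ^ 2 * μ₁ ≤ ε ^ 2 * (N : ℝ) ^ (1 - α) := by
  have hbR : (2 : ℝ) ≤ b := by exact_mod_cast hb
  have hbound := (div_le_div_iff₀ (by positivity) (by positivity)).1 h.2.2
  calc 256 * Real.log N ^ 2 * μ₁ = μ₁ * (64 * 2 * (2 * Real.log N ^ 2)) := by ring
    _ ≤ μ₁ * (64 * b * (2 * Real.log N ^ 2 + 3)) := by gcongr; linarith
    _ ≤ _ := by linarith

end Parameters

end JFSQ

theorem theorem2 (N b r : ℕ) (hN : 2 ≤ N) (hb : 2 ≤ b) (hr : 0 < r) (α ε : ℝ) (hε : 0 < ε)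
    (μ : Fin N → ℝ) (hμ_anti : Antitone μ) (hμ_lower : ∀ n, ε ≤ μ n) (hμ_sum : ∑ n, μ n = N)
    (π : JFSQ.State N b → ℝ) (hπ : JFSQ.IsSteadyState (JFSQ.load N α * N) μ π) :
    -- Sub-Halfin-Whitt regime
    (0 < α → α < 1 / 2 → JFSQ.SubCondition N b r α ε (μ ⟨0, by omega⟩) →
      ∀ (N₂ : ℕ) (_ : 1 ≤ N₂) (_ : N₂ ≤ N),
        JFSQ.load N α * N = ∑ n ∈ univ.filter (fun n : Fin N => (n : ℕ) < N₂), μ n →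
        JFSQ.expect π (fun q =>
            (max (JFSQ.avgQueue q - (N₂ : ℝ) / N
              - (1 - 4 / (JFSQ.kSub b ε (μ ⟨N₂ - 1, by omega⟩) * ε)) * (1 / (N : ℝ) ^ α)) 0) ^ r)
          ≤ (JFSQ.kSub b ε (μ ⟨N₂ - 1, by omega⟩) / (N : ℝ) ^ (1 - α)) ^ r) ∧
    -- Super-Halfin-Whitt regime
    (1 / 2 ≤ α → α < 1 → JFSQ.SuperCondition N b r α ε (μ ⟨0, by omega⟩) →
      JFSQ.expect π (fun q =>
          (max (JFSQ.avgQueue q - 1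
            - JFSQ.kSuper b r ε (μ ⟨0, by omega⟩) * Real.log N / (N : ℝ) ^ (1 - α)) 0) ^ r)
        ≤ 10 * (2 * (r : ℝ) / (N : ℝ) ^ (1 - α)) ^ r) := by
  have hN0 : 0 < N := by omega
  have hx0 : 0 < (N : ℝ) ^ (1 - α) := Real.rpow_pos_of_pos (Nat.cast_pos.2 hN0) _
  have hμ₁ : ∀ n, μ n ≤ μ ⟨0, hN0⟩ := fun n => hμ_anti (Fin.le_def.2 (Nat.zero_le _))
  rw [JFSQ.load_mul hN0] at hπ ⊢
  refine ⟨fun _ _ hcond N₂ hN₂ _ hcap => ?_, fun hα _ hcond => ?_⟩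
  · have hN₂_cast : ((N₂ - 1 : ℕ) : ℝ) + 1 = N₂ := by rw [Nat.cast_sub hN₂, Nat.cast_one]; ring
    have hload : 0 ≤ (N : ℝ) - (N : ℝ) ^ (1 - α) :=
      hcap ▸ sum_nonneg fun n _ => hε.le.trans (hμ_lower n)
    rw [JFSQ.filter_val_lt_eq_Iic (by omega) hN₂] at hcap
    have hbound := JFSQ.expect_le_of_large_capacity hN0 hb hμ_anti hε hμ_lower hcond.le_half hμ_sum
      hr hx0 hload hπ hcap.symm (hcond.two_mul_le hN) (hcond.sqrt_le hN0)
      (hcond.rate_le hb hε (hε.le.trans (hμ_lower _)))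
    simpa only [hN₂_cast, JFSQ.rpow_one_sub_div hN0] using hbound
  · exact JFSQ.expect_le_of_sq_le hN hb hr hε hμ_lower hμ₁ hμ_sum hx0
      (JFSQ.sq_rpow_one_sub_le hN0 hα) hπ hcond
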